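/- **Setting.** For a polygon $P\subseteq\mathbf R^2$ (a nonempty compact set that is the closure of its interior and whose boundary is contained in finitely many segments; holes are allowed), let $d(P)$ be its diameter. For $r\ge 0$ let $P^+(r)$ be the set of points at distance at most $r$ from some point of the interior of $P$, and let $P^-(r)$ be the set of points that are not at distance at most $r$ from a point exterior to $P$. For $\phi>0$ write $P^\pm=P^\pm(\phi\, d(P))$. A *valid Jaccard similarity* of $P_1,P_2$ in the fuzzy model with parameter $\phi$ is any number $X_\cap/X_\cup$ with $X_\cup>0$, $A(P_1^-\cap P_2^-)\le X_\cap\le A(P_1^+\cap P_2^+)$ and $A(P_1^-\cup P_2^-)\le X_\cup\le A(P_1^+\cup P_2^+)$, where $A$ denotes area. A set $S$ is *$\alpha$-dense* in $I$ if $A(S)\ge\alpha A(I)$. The model of computation is a Word RAM with words of $w$ bits. Besides the usual word operations, which take unit time, it can test, in time $t\ge1$, whether the point with given coordinates of a fixed $p\times p$ grid lies in the range $P^+(\phi\, d(P)/2)$ of the polygon $P$ to be hashed (the point-in-polygon test); this is its only access to $P$. **Theorem 2.** For all constants $\varepsilon,\phi>0$ there are a program, integers $k_1,k_2$ and a constant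 $C>0$ such that the following holds for every square $I\subseteq\mathbf R^2$, every $\alpha\in(0,1]$, every prime $p\ge C/\alpha$ and every word size $w\ge\log_2 p$. There are a $p\times p$ square grid whose enclosing square contains $I$, and $k_1$ fixed words, such that the program, given these words and a seed $\sigma$ of $k_2$ elements of $\{0,\dots,p-1\}$ (a description of constant size), computes for every polygon $P\subseteq I$ and every seed a hash value $H_\sigma(P)$ in time at most $C\,(t\log p)/\alpha$, where $H_\sigma(P)$ does not depend on $t$; and such that, for all polygons $P_1,P_2\subseteq I$ for which $P_1^+$ and $P_2^+$ are $\alpha$-dense in $I$, there is a valid Jaccard similarity $J$ of $P_1$ and $P_2$ in the fuzzy model with parameter $\phi$ with $$\Pr[H_\sigma(P_1)=H_\sigma(P_2)]\in[J-\varepsilon,\,J+\varepsilon],$$ where $\sigma$ is uniformly distributed. -/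

import Mathlib

open MeasureTheory Set

noncomputable section

namespace GeomLSH

/-! ### Plane geometry and the fuzzy model -/

/-- The Euclidean plane. -/
abbrev Plane := EuclideanSpace ℝ (Fin 2)

/-- Rotation by a right angle. -/
def rot (v : Plane) : Plane := !₂[-(v 1), v 0]

/-- The closed square with corner `o` and edge vectors `v` and `rot v`. -/
def square (o v : Plane) : Set Plane :=
  {x | ∃ a ∈ Icc (0 : ℝ) 1, ∃ b ∈ Icc (0 : ℝ) 1, x = o + a • v + b • rot v}

/-- The point with integer coordinates `(i, j)` in the square grid with origin `o` and
step `v`. -/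
def gridPoint (o v : Plane) (i j : ℕ) : Plane := o + (i : ℝ) • v + (j : ℝ) • rot v

/-- Polygons, as closed regions of the plane: compact sets that are the closure of their
(nonempty) interior and whose boundary consists of finitely many line segments. Neither
convexity nor simple connectedness is required (holes are allowed). -/
structure IsPolygon (P : Set Plane) : Prop where
  compact : IsCompact P
  nonempty : P.Nonempty
  regular : closure (interior P) = P
  edges : ∃ E : Finset (Plane × Plane), frontier P ⊆ ⋃ e ∈ E, segment ℝ e.1 e.2

/-- Area. -/
def area (S : Set Plane) : ℝ := (volume S).toReal

/-- The outer range: the locus of points whose distance from a point interior to `P` is at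
most `r`. -/
def outerRange (P : Set Plane) (r : ℝ) : Set Plane :=
  {x | ∃ y ∈ interior P, dist x y ≤ r}

/-- The inner range, defined symmetrically: the points that are not within distance `r` of a
point exterior to `P`. -/
def innerRange (P : Set Plane) (r : ℝ) : Set Plane :=
  {x | ¬ ∃ y ∈ interior Pᶜ, dist x y ≤ r}

/-- The width `w = φ · d(P)`, where `d(P)` is the diameter of `P`. -/
def fuzzWidth (φ : ℝ) (P : Set Plane) : ℝ := φ * Metric.diam P

/-- `S` is `α`-dense in `I`: its area is at least a fraction `α` of the area of `I`. -/
def IsDenseIn (α : ℝ) (S I : Set Plane) : Prop := α * area I ≤ area S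

/-- `J` is a valid Jaccard similarity of `P₁` and `P₂` in the fuzzy model with parameter `φ`. -/
def IsValidJaccard (φ : ℝ) (P₁ P₂ : Set Plane) (J : ℝ) : Prop :=
  ∃ X Y : ℝ,
    area (innerRange P₁ (fuzzWidth φ P₁) ∩ innerRange P₂ (fuzzWidth φ P₂)) ≤ X ∧
    X ≤ area (outerRange P₁ (fuzzWidth φ P₁) ∩ outerRange P₂ (fuzzWidth φ P₂)) ∧
    area (innerRange P₁ (fuzzWidth φ P₁) ∪ innerRange P₂ (fuzzWidth φ P₂)) ≤ Y ∧
    Y ≤ area (outerRange P₁ (fuzzWidth φ P₁) ∪ outerRange P₂ (fuzzWidth φ P₂)) ∧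
    0 < Y ∧ J = X / Y

/-! ### A Word RAM with a membership test

Words are bit vectors of length `w`; the memory has one word for each address, an address being
a word. Arithmetic is unsigned and modulo `2 ^ w`. -/

/-- The arithmetic operations of the machine. -/
inductive ArithOp
  | add | sub | mul | div | mod

/-- The result of an arithmetic operation on words (division by zero gives zero,
and `x mod 0 = x`). -/
def ArithOp.apply {w : ℕ} : ArithOp → BitVec w → BitVec w → BitVec w
  | add, x, y => x + y
  | sub, x, y => x - y
  | mul, x, y => x * y
  | div, x, y => x / y
  | mod, x, y => x % y

/-- Instructions. The natural numbers `d`, `a`, `b` are memory addresses,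
`M[a]` is the word stored at address `a`. -/
inductive Instr
  /-- `M[d] := c` -/
  | const (d c : ℕ)
  /-- `M[d] := M[a] ∘ M[b]` -/
  | arith (f : ArithOp) (d a b : ℕ)
  /-- `M[d] := M[M[a]]` -/
  | load (d a : ℕ)
  /-- `M[M[a]] := M[b]` -/
  | store (a b : ℕ)
  /-- if `M[a] < M[b]` then go to instruction number `l` -/
  | jumpLt (a b l : ℕ)
  /-- `M[d] := 1` if the grid point with coordinates `(M[a], M[b])` passes the membership test,
  and `M[d] := 0` otherwise -/
  | test (d a b : ℕ)

/-- A program is a finite list of instructions, numbered from `0`. -/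
abbrev Program := List Instr

/-- A configuration: the program counter and the memory. -/
structure Config (w : ℕ) where
  pc : ℕ
  mem : BitVec w → BitVec w

/-- The word stored at address `a`. -/
def Config.get {w : ℕ} (c : Config w) (a : ℕ) : BitVec w := c.mem (BitVec.ofNat w a)

/-- Write the word `x` to address `a` and advance the program counter. -/
def Config.write {w : ℕ} (c : Config w) (a x : BitVec w) : Config w :=
  ⟨c.pc + 1, Function.update c.mem a x⟩

open Classical in
/-- The effect of one instruction. `inside i j` says whether the grid point with coordinates
`(i, j)` passes the membership test. -/
def Instr.exec {w : ℕ} (inside : ℕ → ℕ → Prop) (c : Config w) : Instr → Config w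
  | const d x => c.write (BitVec.ofNat w d) (BitVec.ofNat w x)
  | arith f d a b => c.write (BitVec.ofNat w d) (f.apply (c.get a) (c.get b))
  | load d a => c.write (BitVec.ofNat w d) (c.mem (c.get a))
  | store a b => c.write (c.get a) (c.get b)
  | jumpLt a b l => ⟨if c.get a < c.get b then l else c.pc + 1, c.mem⟩
  | test d a b => c.write (BitVec.ofNat w d)
      (if inside (c.get a).toNat (c.get b).toNat then 1 else 0)

/-- The time taken by an instruction: `t` for a membership test, one unit for any other. -/
def Instr.cost (t : ℕ) : Instr → ℕ
  | test _ _ _ => t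
  | _ => 1

/-- `Runs prog inside t c out T`: started in configuration `c`, the program halts after time
`T` with the word `out` at address `0`. It halts when the program counter leaves the program. -/
inductive Runs {w : ℕ} (prog : Program) (inside : ℕ → ℕ → Prop) (t : ℕ) :
    Config w → BitVec w → ℕ → Prop
  | halt (c : Config w) : prog[c.pc]? = none → Runs prog inside t c (c.get 0) 0
  | step (c : Config w) (i : Instr) (out : BitVec w) (T : ℕ) : prog[c.pc]? = some i →
      Runs prog inside t (i.exec inside c) out T →
      Runs prog inside t c out (i.cost t + T)

/-- The initial configuration: the words of the list `desc` are stored at the addresses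
`0, 1, 2, …`, all other words are zero. -/
def initConfig {w : ℕ} (desc : List (BitVec w)) : Config w :=
  ⟨0, fun a => desc.getD a.toNat 0⟩

/-! ### Random hash functions -/

/-- The description of a hash function: the words `params`, followed by a seed of `k` elements
of `U = {0, …, p - 1}`, one word each. -/
def description {w k p : ℕ} (params : List (BitVec w)) (seed : Fin k → Fin p) :
    List (BitVec w) :=
  params ++ List.ofFn fun i => BitVec.ofNat w (seed i : ℕ)

/-- The membership test for the polygon `P` that the machine can use: for the points of the
`p × p` grid with origin `o` and step `v` it tells whether the point lies in `P⁺(w/2)`,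
where `w = φ · d(P)`. -/
def insideTest (φ : ℝ) (o v : Plane) (p : ℕ) (P : Set Plane) (i j : ℕ) : Prop :=
  i < p ∧ j < p ∧ gridPoint o v i j ∈ outerRange P (fuzzWidth φ P / 2)

/-- The probability that `H P₁ = H P₂`, for a seed uniformly distributed in `U ^ k`. -/
def collisionProb {k p : ℕ} {α β : Type*} (H : (Fin k → Fin p) → α → β) (P₁ P₂ : α) : ℝ :=
  (Nat.card {seed : Fin k → Fin p // H seed P₁ = H seed P₂} : ℝ) / (p : ℝ) ^ k

end GeomLSH

end

open GeomLSH

namespace GeomLSH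

/-! ### The first hit of a sequence -/

/-! The hash value is the index of the first sample point that hits the half range `P⁺(w/2)`. Let
A₁, A₂ be the sets of grid points in the half ranges of two polygons. For fully independent uniform
samples the two indices agree with probability |A₁ ∩ A₂| / |A₁ ∪ A₂|, since the first sample in the
union has to lie in the intersection.

A seed of constant size gives only k-wise independence. The n-th point is (f(n), g(n)) for random
polynomials f, g of degree less than k modulo `p`, advanced by a difference table (`diffTable_cast`,
`runs_sampleProg`); interpolation gives the independence (`samplePoint_kWiseUniform`). Truncated
inclusion-exclusion approximates the probabilities that the first hit of U = A₁ ∪ A₂ occurs at i,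
and that it also lies in B = A₁ ∩ A₂, by multiples of one and the same sum. So their ratio is nearly
|B| / |U|, whatever that sum is (`abs_sum_firstProb_sub_le`). Chebyshev's inequality bounds the
probability of no hit (`missProb_le`). Looking at about 2 / (ε · density) samples makes both errors
small for a constant k (`exists_collision_approx`).

Geometrically, each point of a grid cell is within w/2 of its corner. The cells whose corners lie in
the half range therefore cover `P⁻` and stay inside `P⁺`, so the Jaccard similarity of the grid sets
is valid (`isValidJaccard_grid`). Density of `P⁺` bounds the diameter of P from below, which makes
the grid fine enough and the hit density at least a constant times α
(`fuzzWidth_and_density_bounds`); hence O(1/α) samples suffice. -/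

/-- The least `n < m` such that `s n`, and `m` if there is none. -/
noncomputable def firstHit (m : ℕ) (s : ℕ → Prop) : ℕ := sInf {n | m ≤ n ∨ s n}

lemma firstHit_mem (m : ℕ) (s : ℕ → Prop) : m ≤ firstHit m s ∨ s (firstHit m s) :=
  Nat.sInf_mem (s := {n | m ≤ n ∨ s n}) ⟨m, Or.inl le_rfl⟩

lemma firstHit_le (m : ℕ) (s : ℕ → Prop) : firstHit m s ≤ m :=
  Nat.sInf_le (Or.inl le_rfl)

lemma firstHit_le_of_hit {m n : ℕ} {s : ℕ → Prop} (h : s n) : firstHit m s ≤ n :=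
  Nat.sInf_le (Or.inr h)

lemma not_of_lt_firstHit {m n : ℕ} {s : ℕ → Prop} (h : n < firstHit m s) : ¬ s n :=
  fun hs => (firstHit_le_of_hit hs).not_gt h

lemma firstHit_eq {m n : ℕ} {s : ℕ → Prop} (hn : n ≤ m) (h : m ≤ n ∨ s n)
    (hlt : ∀ i < n, ¬ s i) : firstHit m s = n := by
  apply le_antisymm (Nat.sInf_le h)
  by_contra! hc
  rcases firstHit_mem m s with h1 | h1
  · exact absurd (h1.trans_lt hc) hn.not_gt
  · exact hlt _ hc h1

/-! ### Difference tables modulo `p` -/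

/-- The difference table `d` after `n` rounds of `d i := d i + d (i + 2)` modulo `p`. -/
def diffTable (p : ℕ) (d : ℕ → ℕ) : ℕ → ℕ → ℕ
  | 0, i => d i
  | n + 1, i => (diffTable p d n i + diffTable p d n (i + 2)) % p

lemma diffTable_lt {p : ℕ} (hp : 0 < p) {d : ℕ → ℕ} (hd : ∀ i, d i < p) (n i : ℕ) :
    diffTable p d n i < p := by
  cases n with
  | zero => exact hd i
  | succ n => exact Nat.mod_lt _ hp

lemma diffTable_eq_zero {p K : ℕ} {d : ℕ → ℕ} (hd : ∀ i, K ≤ i → d i = 0) (n i : ℕ)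
    (hi : K ≤ i) : diffTable p d n i = 0 := by
  induction n generalizing i with
  | zero => exact hd i hi
  | succ n ih => simp [diffTable, ih i hi, ih (i + 2) (by omega)]

/-- The difference table after `n` rounds and `j` steps of the next round. -/
def partialTable (p : ℕ) (d : ℕ → ℕ) (n j i : ℕ) : ℕ :=
  if i < j then diffTable p d (n + 1) i else diffTable p d n i

/-! ### The program -/

/-- Instruction number `q` of the program that runs over the points of a difference table with
`K` entries until one of them passes the membership test. -/
def sampleInstr (K q : ℕ) : Instr :=
  -- Addresses: 0 counter and output, 1 sample bound, 2 modulus, 3 and 4 the constants one and zero,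
  -- 5 scratch, 6 onwards the table. Its first two entries are the current point.
  if q = 0 then .test 5 6 7
  else if q = 1 then .jumpLt 4 5 (4 * K + 4)
  else if q = 2 then .arith .add 0 0 3
  else if q = 4 * K + 3 then .jumpLt 0 1 0
  -- Four instructions per modular addition x + y. The sum may overflow a word, so x is compared
  -- with p - y, and p is subtracted first if necessary.
  else if (q - 3) % 4 = 0 then .arith .sub 5 2 (8 + (q - 3) / 4)
  else if (q - 3) % 4 = 1 then .jumpLt (6 + (q - 3) / 4) 5 (q + 2)
  else if (q - 3) % 4 = 2 then .arith .sub (6 + (q - 3) / 4) (6 + (q - 3) / 4) 2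
  else .arith .add (6 + (q - 3) / 4) (6 + (q - 3) / 4) (8 + (q - 3) / 4)

/-- The sampling program for difference tables with `K` entries. -/
def sampleProg (K : ℕ) : Program := (List.range (4 * K + 4)).map (sampleInstr K)

lemma sampleProg_get {K q : ℕ} (hq : q < 4 * K + 4) :
    (sampleProg K)[q]? = some (sampleInstr K q) := by
  simp [sampleProg, hq]

lemma sampleProg_get_end (K : ℕ) : (sampleProg K)[4 * K + 4]? = none := by
  simp [sampleProg]

lemma sampleInstr_block {K i : ℕ} (hi : i < K) :
    sampleInstr K (3 + 4 * i) = .arith .sub 5 2 (8 + i) ∧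
    sampleInstr K (3 + 4 * i + 1) = .jumpLt (6 + i) 5 (3 + 4 * i + 3) ∧
    sampleInstr K (3 + 4 * i + 2) = .arith .sub (6 + i) (6 + i) 2 ∧
    sampleInstr K (3 + 4 * i + 3) = .arith .add (6 + i) (6 + i) (8 + i) := by
  have h0 : (3 + 4 * i - 3) % 4 = 0 := by omega
  have h1 : (3 + 4 * i + 1 - 3) % 4 = 1 := by omega
  have h2 : (3 + 4 * i + 2 - 3) % 4 = 2 := by omega
  have h3 : (3 + 4 * i + 3 - 3) % 4 = 3 := by omega
  have g0 : (3 + 4 * i - 3) / 4 = i := by omega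
  have g1 : (3 + 4 * i + 1 - 3) / 4 = i := by omega
  have g2 : (3 + 4 * i + 2 - 3) / 4 = i := by omega
  have g3 : (3 + 4 * i + 3 - 3) / 4 = i := by omega
  refine ⟨?_, ?_, ?_, ?_⟩ <;> unfold sampleInstr
  · rw [if_neg (by omega), if_neg (by omega), if_neg (by omega), if_neg (by omega), if_pos h0, g0]
  · rw [if_neg (by omega), if_neg (by omega), if_neg (by omega), if_neg (by omega), h1,
      if_neg (by omega), if_pos rfl, g1]
  · rw [if_neg (by omega), if_neg (by omega), if_neg (by omega), if_neg (by omega), h2,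
      if_neg (by omega), if_neg (by omega), if_pos rfl, g2]
  · rw [if_neg (by omega), if_neg (by omega), if_neg (by omega), if_neg (by omega), h3,
      if_neg (by omega), if_neg (by omega), if_neg (by omega), g3]

/-! ### Reachability with a time bound -/

section Machine

variable {w : ℕ}

/-- A halting run from `c'` extends to one from `c` that takes at most `B` units longer. -/
def Reaches (prog : Program) (inside : ℕ → ℕ → Prop) (t B : ℕ) (c c' : Config w) : Prop :=
  ∀ out T, Runs prog inside t c' out T → ∃ T' ≤ B + T, Runs prog inside t c out T'

variable {prog : Program} {inside : ℕ → ℕ → Prop} {t : ℕ}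

lemma Reaches.trans {B B' : ℕ} {c c' c'' : Config w} (h : Reaches prog inside t B c c')
    (h' : Reaches prog inside t B' c' c'') : Reaches prog inside t (B + B') c c'' := by
  intro out T hr
  obtain ⟨T1, h1, r1⟩ := h' out T hr
  obtain ⟨T2, h2, r2⟩ := h out T1 r1
  exact ⟨T2, by omega, r2⟩

lemma Reaches.mono {B B' : ℕ} {c c' : Config w} (h : Reaches prog inside t B c c')
    (hB : B ≤ B') : Reaches prog inside t B' c c' := by
  intro out T hr
  obtain ⟨T1, h1, r1⟩ := h out T hr
  exact ⟨T1, by omega, r1⟩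

lemma Reaches.refl (c : Config w) : Reaches prog inside t 0 c c :=
  fun _ T hr => ⟨T, by omega, hr⟩

lemma reaches_step {c c' : Config w} {i : Instr} (h : prog[c.pc]? = some i)
    (hc : i.exec inside c = c') : Reaches prog inside t (i.cost t) c c' := by
  intro out T hr
  exact ⟨_, le_rfl, Runs.step c i out T h (hc ▸ hr)⟩

lemma addr_inj {a b : ℕ} (ha : a < 2 ^ w) (hb : b < 2 ^ w) :
    BitVec.ofNat w a = BitVec.ofNat w b ↔ a = b := by
  constructor
  · intro h
    have := congrArg BitVec.toNat h
    simpa [BitVec.toNat_ofNat, Nat.mod_eq_of_lt ha, Nat.mod_eq_of_lt hb] using this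
  · rintro rfl; rfl

lemma addr_toNat {a : ℕ} (ha : a < 2 ^ w) : (BitVec.ofNat w a).toNat = a := by
  simp [BitVec.toNat_ofNat, Nat.mod_eq_of_lt ha]

lemma addr_lt {a b : ℕ} (ha : a < 2 ^ w) (hb : b < 2 ^ w) :
    BitVec.ofNat w a < BitVec.ofNat w b ↔ a < b := by
  rw [BitVec.lt_def, addr_toNat ha, addr_toNat hb]

/-- The memory in the course of the sampling program: the counter is `n`, the difference table
is `d`. -/
structure Layout (m p K n : ℕ) (d : ℕ → ℕ) (mem : BitVec w → BitVec w) : Prop where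
  counter : mem (BitVec.ofNat w 0) = BitVec.ofNat w n
  bound : mem (BitVec.ofNat w 1) = BitVec.ofNat w m
  modulus : mem (BitVec.ofNat w 2) = BitVec.ofNat w p
  one : mem (BitVec.ofNat w 3) = BitVec.ofNat w 1
  zero : mem (BitVec.ofNat w 4) = BitVec.ofNat w 0
  -- Two cells beyond the `K` entries are included because the last two additions read them; they
  -- hold zero throughout.
  table : ∀ i < K + 2, mem (BitVec.ofNat w (6 + i)) = BitVec.ofNat w (d i)

lemma Layout.update_temp {m p K n : ℕ} {d : ℕ → ℕ} {mem : BitVec w → BitVec w}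
    (h : Layout m p K n d mem) (hw : K + 8 ≤ 2 ^ w) (x : BitVec w) :
    Layout m p K n d (Function.update mem (BitVec.ofNat w 5) x) := by
  have key : ∀ a, a < 2 ^ w → a ≠ 5 →
      Function.update mem (BitVec.ofNat w 5) x (BitVec.ofNat w a) = mem (BitVec.ofNat w a) := by
    intro a ha h5
    rw [Function.update_of_ne]
    rwa [Ne, addr_inj ha (by omega)]
  refine ⟨?_, ?_, ?_, ?_, ?_, ?_⟩
  · rw [key _ (by omega) (by omega), h.counter]
  · rw [key _ (by omega) (by omega), h.bound]
  · rw [key _ (by omega) (by omega), h.modulus]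
  · rw [key _ (by omega) (by omega), h.one]
  · rw [key _ (by omega) (by omega), h.zero]
  · intro i hi
    rw [key _ (by omega) (by omega), h.table i hi]

lemma Layout.update_counter {m p K n n' : ℕ} {d : ℕ → ℕ} {mem : BitVec w → BitVec w}
    (h : Layout m p K n d mem) (hw : K + 8 ≤ 2 ^ w) :
    Layout m p K n' d (Function.update mem (BitVec.ofNat w 0) (BitVec.ofNat w n')) := by
  have key : ∀ a, a < 2 ^ w → a ≠ 0 →
      Function.update mem (BitVec.ofNat w 0) (BitVec.ofNat w n') (BitVec.ofNat w a) =
        mem (BitVec.ofNat w a) := by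
    intro a ha h5
    rw [Function.update_of_ne]
    rwa [Ne, addr_inj ha (by omega)]
  refine ⟨?_, ?_, ?_, ?_, ?_, ?_⟩
  · rw [Function.update_self]
  · rw [key _ (by omega) (by omega), h.bound]
  · rw [key _ (by omega) (by omega), h.modulus]
  · rw [key _ (by omega) (by omega), h.one]
  · rw [key _ (by omega) (by omega), h.zero]
  · intro i hi
    rw [key _ (by omega) (by omega), h.table i hi]

lemma Layout.update_table {m p K n j : ℕ} {d : ℕ → ℕ} {mem : BitVec w → BitVec w}
    (h : Layout m p K n d mem) (hw : K + 8 ≤ 2 ^ w) (hj : j < K + 2) (y : ℕ) :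
    Layout m p K n (Function.update d j y)
      (Function.update mem (BitVec.ofNat w (6 + j)) (BitVec.ofNat w y)) := by
  have key : ∀ a, a < 2 ^ w → a ≠ 6 + j →
      Function.update mem (BitVec.ofNat w (6 + j)) (BitVec.ofNat w y) (BitVec.ofNat w a) =
        mem (BitVec.ofNat w a) := by
    intro a ha h5
    rw [Function.update_of_ne]
    rwa [Ne, addr_inj ha (by omega)]
  refine ⟨?_, ?_, ?_, ?_, ?_, ?_⟩
  · rw [key _ (by omega) (by omega), h.counter]
  · rw [key _ (by omega) (by omega), h.bound]
  · rw [key _ (by omega) (by omega), h.modulus]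
  · rw [key _ (by omega) (by omega), h.one]
  · rw [key _ (by omega) (by omega), h.zero]
  · intro i hi
    rcases eq_or_ne i j with rfl | hij
    · simp
    · rw [key _ (by omega) (by omega), h.table i hi, Function.update_of_ne hij]

/-- One modular addition. -/
lemma reaches_block {m p K n i : ℕ} {d : ℕ → ℕ} {mem : BitVec w → BitVec w}
    (h : Layout m p K n d mem) (hw : K + 8 ≤ 2 ^ w) (hp : p < 2 ^ w) (hd : ∀ i, d i < p)
    (hi : i < K) :
    ∃ mem', Layout m p K n (Function.update d i ((d i + d (i + 2)) % p)) mem' ∧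
      Reaches (sampleProg K) inside t 4 ⟨3 + 4 * i, mem⟩ ⟨3 + 4 * (i + 1), mem'⟩ := by
  obtain ⟨b0, b1, b2, b3⟩ := sampleInstr_block hi
  have g0 := (sampleProg_get (K := K) (q := 3 + 4 * i) (by omega)).trans (congrArg some b0)
  have g1 := (sampleProg_get (K := K) (q := 3 + 4 * i + 1) (by omega)).trans (congrArg some b1)
  have g2 := (sampleProg_get (K := K) (q := 3 + 4 * i + 2) (by omega)).trans (congrArg some b2)
  have g3 := (sampleProg_get (K := K) (q := 3 + 4 * i + 3) (by omega)).trans (congrArg some b3)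
  have hx := hd i
  have hy := hd (i + 2)
  set x := d i with hxdef
  set y := d (i + 2) with hydef
  set mem₁ := Function.update mem (BitVec.ofNat w 5) (BitVec.ofNat w (p - y)) with hmem₁
  have h₁ : Layout m p K n d mem₁ := h.update_temp hw _
  have r0 : Reaches (sampleProg K) inside t 1 ⟨3 + 4 * i, mem⟩ ⟨3 + 4 * i + 1, mem₁⟩ := by
    refine reaches_step (i := .arith .sub 5 2 (8 + i)) g0 ?_
    simp only [Instr.exec, Config.write, Config.get, ArithOp.apply, h.modulus]
    rw [show 8 + i = 6 + (i + 2) by omega, h.table (i + 2) (by omega), hmem₁]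
    congr 2
    apply BitVec.eq_of_toNat_eq
    rw [BitVec.toNat_sub, addr_toNat hp, addr_toNat (by omega), addr_toNat (by omega)]
    rw [show 2 ^ w - d (i + 2) + p = (p - y) + 2 ^ w by omega, Nat.add_mod_right,
      Nat.mod_eq_of_lt (by omega)]
  have e6 : mem₁ (BitVec.ofNat w (6 + i)) = BitVec.ofNat w x := h₁.table i (by omega)
  have e8 : mem₁ (BitVec.ofNat w (8 + i)) = BitVec.ofNat w y := by
    rw [show 8 + i = 6 + (i + 2) by omega, h₁.table (i + 2) (by omega)]
  have e5 : mem₁ (BitVec.ofNat w 5) = BitVec.ofNat w (p - y) := by simp [hmem₁]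
  have n86 : BitVec.ofNat w (8 + i) ≠ BitVec.ofNat w (6 + i) := by
    rw [Ne, addr_inj (by omega) (by omega)]; omega
  refine ⟨_, h₁.update_table hw (j := i) (by omega) ((x + y) % p), ?_⟩
  rw [show 3 + 4 * (i + 1) = 3 + 4 * i + 3 + 1 by omega]
  by_cases hc : x < p - y
  · have r1 : Reaches (sampleProg K) inside t 1 ⟨3 + 4 * i + 1, mem₁⟩ ⟨3 + 4 * i + 3, mem₁⟩ := by
      refine reaches_step (i := .jumpLt (6 + i) 5 (3 + 4 * i + 3)) g1 ?_
      simp only [Instr.exec, Config.get, e6, e5]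
      rw [if_pos ((addr_lt (by omega) (by omega)).2 hc)]
    have r2 : Reaches (sampleProg K) inside t 1 ⟨3 + 4 * i + 3, mem₁⟩ ⟨3 + 4 * i + 3 + 1,
        Function.update mem₁ (BitVec.ofNat w (6 + i)) (BitVec.ofNat w ((x + y) % p))⟩ := by
      refine reaches_step (i := .arith .add (6 + i) (6 + i) (8 + i)) g3 ?_
      simp only [Instr.exec, Config.write, Config.get, ArithOp.apply, e6, e8]
      congr 2
      apply BitVec.eq_of_toNat_eq
      rw [BitVec.toNat_add, addr_toNat (by omega), addr_toNat (by omega),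
        Nat.mod_eq_of_lt (a := x + y) (b := p) (by omega), addr_toNat (by omega),
        Nat.mod_eq_of_lt (by omega)]
    exact ((r0.trans r1).trans r2).mono (by omega)
  · have r1 : Reaches (sampleProg K) inside t 1 ⟨3 + 4 * i + 1, mem₁⟩ ⟨3 + 4 * i + 2, mem₁⟩ := by
      refine reaches_step (i := .jumpLt (6 + i) 5 (3 + 4 * i + 3)) g1 ?_
      simp only [Instr.exec, Config.get, e6, e5]
      rw [if_neg (fun h => hc ((addr_lt (by omega) (by omega)).1 h))]
    -- The difference wraps around modulo `2 ^ w`; adding y afterwards undoes the wrap.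
    set z := BitVec.ofNat w x - BitVec.ofNat w p with hz
    have r2 : Reaches (sampleProg K) inside t 1 ⟨3 + 4 * i + 2, mem₁⟩ ⟨3 + 4 * i + 3,
        Function.update mem₁ (BitVec.ofNat w (6 + i)) z⟩ := by
      refine reaches_step (i := .arith .sub (6 + i) (6 + i) 2) g2 ?_
      simp only [Instr.exec, Config.write, Config.get, ArithOp.apply, e6, h₁.modulus, hz]
    have r3 : Reaches (sampleProg K) inside t 1 ⟨3 + 4 * i + 3,
        Function.update mem₁ (BitVec.ofNat w (6 + i)) z⟩ ⟨3 + 4 * i + 3 + 1,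
        Function.update mem₁ (BitVec.ofNat w (6 + i)) (BitVec.ofNat w ((x + y) % p))⟩ := by
      refine reaches_step (i := .arith .add (6 + i) (6 + i) (8 + i)) g3 ?_
      simp only [Instr.exec, Config.write, Config.get, ArithOp.apply, Function.update_self,
        Function.update_of_ne n86, e8, Function.update_idem]
      congr 2
      have hxy : (x + y) % p = x + y - p := by
        rw [Nat.mod_eq_sub_mod (by omega), Nat.mod_eq_of_lt (by omega)]
      apply BitVec.eq_of_toNat_eq
      rw [hz, BitVec.toNat_add, BitVec.toNat_sub, addr_toNat (by omega), addr_toNat (by omega),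
        addr_toNat (by omega), hxy, addr_toNat (by omega), Nat.mod_add_mod,
        show 2 ^ w - p + x + y = (x + y - p) + 2 ^ w by omega, Nat.add_mod_right,
        Nat.mod_eq_of_lt (by omega)]
    exact (((r0.trans r1).trans r2).trans r3).mono (by omega)

/-- The pass can be done in place: going upwards, entry j + 2 still has its old value when entry j
is overwritten. -/
lemma reaches_blocks {m p K n n' : ℕ} {d : ℕ → ℕ} {mem : BitVec w → BitVec w}
    (hw : K + 8 ≤ 2 ^ w) (hp : p < 2 ^ w) (hd : ∀ i, d i < p)
    (h : Layout m p K n' (diffTable p d n) mem) (j : ℕ) (hj : j ≤ K) :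
    ∃ mem', Layout m p K n' (partialTable p d n j) mem' ∧
      Reaches (sampleProg K) inside t (4 * j) ⟨3, mem⟩ ⟨3 + 4 * j, mem'⟩ := by
  have hp0 : 0 < p := (Nat.zero_le _).trans_lt (hd 0)
  induction j with
  | zero =>
    refine ⟨mem, ?_, Reaches.refl _⟩
    have : partialTable p d n 0 = diffTable p d n := by ext i; simp [partialTable]
    rwa [this]
  | succ j ih =>
    obtain ⟨mem₁, h₁, r₁⟩ := ih (by omega)
    have hlt : ∀ i, partialTable p d n j i < p := by
      intro i
      unfold partialTable
      split_ifs <;> exact diffTable_lt hp0 hd _ _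
    obtain ⟨mem₂, h₂, r₂⟩ := reaches_block (inside := inside) (t := t) h₁ hw hp hlt
      (i := j) (by omega)
    refine ⟨mem₂, ?_, (r₁.trans r₂).mono (by omega)⟩
    convert h₂ using 1
    ext i
    rcases lt_trichotomy i j with hij | rfl | hij
    · rw [Function.update_of_ne hij.ne]
      simp [partialTable, hij, Nat.lt_succ_of_lt hij]
    · simp [partialTable, diffTable]
    · rw [Function.update_of_ne hij.ne']
      have : ¬ i < j + 1 := by omega
      simp [partialTable, this, hij.not_gt]

lemma exec_test_pos {c : Config w} {d a b : ℕ} (h : inside (c.get a).toNat (c.get b).toNat) :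
    (Instr.test d a b).exec inside c = c.write (BitVec.ofNat w d) (BitVec.ofNat w 1) := by
  simp [Instr.exec, h]

lemma exec_test_neg {c : Config w} {d a b : ℕ} (h : ¬ inside (c.get a).toNat (c.get b).toNat) :
    (Instr.test d a b).exec inside c = c.write (BitVec.ofNat w d) (BitVec.ofNat w 0) := by
  simp [Instr.exec, h]

lemma exec_jumpLt_pos {c : Config w} {a b l : ℕ} (h : c.get a < c.get b) :
    (Instr.jumpLt a b l).exec inside c = ⟨l, c.mem⟩ := by
  simp [Instr.exec, h]

lemma exec_jumpLt_neg {c : Config w} {a b l : ℕ} (h : ¬ c.get a < c.get b) :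
    (Instr.jumpLt a b l).exec inside c = ⟨c.pc + 1, c.mem⟩ := by
  simp only [Instr.exec, if_neg h]

lemma reaches_hit {m p K n : ℕ} {d : ℕ → ℕ} {mem : BitVec w → BitVec w} (hw : K + 8 ≤ 2 ^ w)
    (h : Layout m p K n d mem) (hlt : ∀ i, d i < 2 ^ w) (hin : inside (d 0) (d 1)) :
    ∃ mem', Layout m p K n d mem' ∧
      Reaches (sampleProg K) inside t (t + 1) ⟨0, mem⟩ ⟨4 * K + 4, mem'⟩ := by
  have e6 : mem (BitVec.ofNat w 6) = _ := h.table 0 (by omega)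
  have e7 : mem (BitVec.ofNat w 7) = _ := h.table 1 (by omega)
  set mem₁ := Function.update mem (BitVec.ofNat w 5) (BitVec.ofNat w 1) with hmem₁
  have e5 : mem₁ (BitVec.ofNat w 5) = BitVec.ofNat w 1 := Function.update_self ..
  have h₁ : Layout m p K n d mem₁ := h.update_temp hw _
  refine ⟨mem₁, h₁, ?_⟩
  have r0 : Reaches (sampleProg K) inside t t ⟨0, mem⟩ ⟨1, mem₁⟩ := by
    refine reaches_step (i := .test 5 6 7) (sampleProg_get (q := 0) (by omega)) ?_
    refine exec_test_pos ?_
    simp only [Config.get]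
    rwa [e6, e7, addr_toNat (hlt _), addr_toNat (hlt _)]
  have r1 : Reaches (sampleProg K) inside t 1 ⟨1, mem₁⟩ ⟨4 * K + 4, mem₁⟩ := by
    refine reaches_step (i := .jumpLt 4 5 (4 * K + 4)) (sampleProg_get (q := 1) (by omega)) ?_
    refine exec_jumpLt_pos ?_
    simp only [Config.get]
    rw [h₁.zero, e5, addr_lt (by omega) (by omega)]
    exact Nat.zero_lt_one
  exact r0.trans r1

lemma reaches_miss {m p K n : ℕ} {d : ℕ → ℕ} {mem : BitVec w → BitVec w} (hw : K + 8 ≤ 2 ^ w)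
    (hp : p < 2 ^ w) (hd : ∀ i, d i < p) (hd0 : ∀ i, K ≤ i → d i = 0)
    (h : Layout m p K n (diffTable p d n) mem)
    (hin : ¬ inside (diffTable p d n 0) (diffTable p d n 1)) :
    ∃ mem', Layout m p K (n + 1) (diffTable p d (n + 1)) mem' ∧
      Reaches (sampleProg K) inside t (t + 2 + 4 * K) ⟨0, mem⟩ ⟨3 + 4 * K, mem'⟩ := by
  have hlt : ∀ i, diffTable p d n i < 2 ^ w := fun i =>
    (diffTable_lt ((Nat.zero_le _).trans_lt (hd 0)) hd n i).trans hp
  have e6 : mem (BitVec.ofNat w 6) = _ := h.table 0 (by omega)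
  have e7 : mem (BitVec.ofNat w 7) = _ := h.table 1 (by omega)
  set mem₁ := Function.update mem (BitVec.ofNat w 5) (BitVec.ofNat w 0) with hmem₁
  have e5 : mem₁ (BitVec.ofNat w 5) = BitVec.ofNat w 0 := Function.update_self ..
  have h₁ : Layout m p K n (diffTable p d n) mem₁ := h.update_temp hw _
  have r0 : Reaches (sampleProg K) inside t t ⟨0, mem⟩ ⟨1, mem₁⟩ := by
    refine reaches_step (i := .test 5 6 7) (sampleProg_get (q := 0) (by omega)) ?_
    refine exec_test_neg ?_
    simp only [Config.get]
    rwa [e6, e7, addr_toNat (hlt _), addr_toNat (hlt _)]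
  have r1 : Reaches (sampleProg K) inside t 1 ⟨1, mem₁⟩ ⟨2, mem₁⟩ := by
    refine reaches_step (i := .jumpLt 4 5 (4 * K + 4)) (sampleProg_get (q := 1) (by omega)) ?_
    refine exec_jumpLt_neg ?_
    simp only [Config.get]
    rw [h₁.zero, e5, addr_lt (by omega) (by omega)]
    exact lt_irrefl _
  set mem₂ := Function.update mem₁ (BitVec.ofNat w 0) (BitVec.ofNat w (n + 1)) with hmem₂
  have h₂ : Layout m p K (n + 1) (diffTable p d n) mem₂ := h₁.update_counter hw
  have r2 : Reaches (sampleProg K) inside t 1 ⟨2, mem₁⟩ ⟨3, mem₂⟩ := by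
    refine reaches_step (i := .arith .add 0 0 3) (sampleProg_get (q := 2) (by omega)) ?_
    simp only [Instr.exec, Config.write, Config.get, ArithOp.apply, h₁.counter, h₁.one, hmem₂]
    rw [BitVec.ofNat_add]
  obtain ⟨mem₃, h₃, r3⟩ := reaches_blocks (inside := inside) (t := t) hw hp hd h₂ K le_rfl
  have h₃' : Layout m p K (n + 1) (diffTable p d (n + 1)) mem₃ := by
    convert h₃ using 1
    ext i
    by_cases hi : i < K
    · simp [partialTable, hi]
    · simp only [partialTable, hi, if_false]
      rw [diffTable_eq_zero hd0 _ _ (by omega), diffTable_eq_zero hd0 _ _ (by omega)]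
  exact ⟨mem₃, h₃', ((r0.trans r1).trans r2).trans r3⟩

/-- Induction on the remaining rounds. A round costs at most t + 4K + 3, which is at most (4K + 4)t
because t ≥ 1. -/
lemma runs_of_layout {m p K : ℕ} {d : ℕ → ℕ} (hw : K + 8 ≤ 2 ^ w) (hp : p < 2 ^ w)
    (hm : m < 2 ^ w) (hd : ∀ i, d i < p) (hd0 : ∀ i, K ≤ i → d i = 0) (ht : 1 ≤ t)
    (r n : ℕ) (hr : n + r + 1 = m) {mem : BitVec w → BitVec w}
    (h : Layout m p K n (diffTable p d n) mem)
    (hn : ∀ i < n, ¬ inside (diffTable p d i 0) (diffTable p d i 1)) :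
    ∃ T ≤ (r + 1) * ((4 * K + 4) * t),
      Runs (sampleProg K) inside t ⟨0, mem⟩
        (BitVec.ofNat w (firstHit m fun i => inside (diffTable p d i 0) (diffTable p d i 1))) T := by
  have hKt : K ≤ K * t := Nat.le_mul_of_pos_right K ht
  have g4 : (sampleProg K)[3 + 4 * K]? = some (.jumpLt 0 1 0) := by
    rw [sampleProg_get (by omega)]
    congr 1
    unfold sampleInstr
    rw [if_neg (by omega), if_neg (by omega), if_neg (by omega), if_pos (by omega)]
  induction r using Nat.strong_induction_on generalizing n mem with
  | _ r ih =>
    have hn' : ¬ inside (diffTable p d n 0) (diffTable p d n 1) →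
        ∀ i < n + 1, ¬ inside (diffTable p d i 0) (diffTable p d i 1) := by
      intro hin i hi
      rcases Nat.lt_succ_iff_lt_or_eq.1 hi with hi | rfl
      · exact hn i hi
      · exact hin
    by_cases hin : inside (diffTable p d n 0) (diffTable p d n 1)
    · obtain ⟨mem₁, h₁, r₁⟩ := reaches_hit (t := t) hw h (fun i =>
        (diffTable_lt ((Nat.zero_le _).trans_lt (hd 0)) hd n i).trans hp) hin
      have hh : firstHit m (fun i => inside (diffTable p d i 0) (diffTable p d i 1)) = n :=
        firstHit_eq (by omega) (Or.inr hin) hn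
      obtain ⟨T, hT, rT⟩ := r₁ _ 0 (Runs.halt _ (sampleProg_get_end K))
      refine ⟨T, hT.trans ?_, ?_⟩
      · calc t + 1 + 0 ≤ 1 * ((4 * K + 4) * t) := by linarith
          _ ≤ _ := Nat.mul_le_mul_right _ (by omega)
      · rw [hh, ← h₁.counter]; exact rT
    obtain ⟨mem₁, h₁, r₁⟩ := reaches_miss (t := t) hw hp hd hd0 h hin
    -- With no round left the counter has reached `m`, the loop falls through, and the output `m`
    -- signals that there was no hit.
    cases r with
    | zero =>
      have r₂ : Reaches (sampleProg K) inside t 1 ⟨3 + 4 * K, mem₁⟩ ⟨4 * K + 4, mem₁⟩ := by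
        refine reaches_step (i := .jumpLt 0 1 0) g4 ?_
        simp only [Instr.exec, Config.get, h₁.counter, h₁.bound]
        rw [if_neg (fun h => by
          have := (addr_lt (by omega) (by omega)).1 h
          omega), show 3 + 4 * K + 1 = 4 * K + 4 by omega]
      have hh : firstHit m (fun i => inside (diffTable p d i 0) (diffTable p d i 1)) = n + 1 :=
        firstHit_eq (by omega) (Or.inl (by omega)) (hn' hin)
      obtain ⟨T, hT, rT⟩ := (r₁.trans r₂) _ 0 (Runs.halt _ (sampleProg_get_end K))
      refine ⟨T, hT.trans ?_, ?_⟩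
      · linarith
      · rw [hh, ← h₁.counter]; exact rT
    | succ r =>
      have r₂ : Reaches (sampleProg K) inside t 1 ⟨3 + 4 * K, mem₁⟩ ⟨0, mem₁⟩ := by
        refine reaches_step (i := .jumpLt 0 1 0) g4 ?_
        simp only [Instr.exec, Config.get, h₁.counter, h₁.bound]
        rw [if_pos ((addr_lt (by omega) (by omega)).2 (by omega))]
      obtain ⟨T₀, hT₀, rT₀⟩ := ih r (by omega) (n + 1) (by omega) h₁ (hn' hin)
      obtain ⟨T, hT, rT⟩ := (r₁.trans r₂) _ _ rT₀
      refine ⟨T, hT.trans ?_, rT⟩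
      linarith

end Machine

/-! ### The description of a hash function as initial memory -/

/-- The difference table given by a seed. -/
def seedTable {K p : ℕ} (seed : Fin K → Fin p) (i : ℕ) : ℕ :=
  if h : i < K then (seed ⟨i, h⟩ : ℕ) else 0

/-- The fixed words of the description. -/
def sampleParams (w m p : ℕ) : List (BitVec w) :=
  [0, BitVec.ofNat w m, BitVec.ofNat w p, BitVec.ofNat w 1, 0, 0]

/-- The six fixed words fill addresses 0 to 5, so the seed starts where the table does; the default
value of `getD` supplies the two zeros after it. -/
lemma layout_init {w m p K : ℕ} (hw : K + 8 ≤ 2 ^ w) (seed : Fin K → Fin p) :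
    Layout m p K 0 (seedTable seed)
      (initConfig (description (sampleParams w m p) seed)).mem := by
  have key : ∀ a, a < 2 ^ w →
      (initConfig (description (sampleParams w m p) seed)).mem (BitVec.ofNat w a) =
        (description (sampleParams w m p) seed).getD a 0 := by
    intro a ha
    simp only [initConfig, addr_toNat ha]
  refine ⟨?_, ?_, ?_, ?_, ?_, ?_⟩
  · rw [key _ (by omega)]; simp [description, sampleParams]
  · rw [key _ (by omega)]; simp [description, sampleParams]
  · rw [key _ (by omega)]; simp [description, sampleParams]
  · rw [key _ (by omega)]; simp [description, sampleParams]
  · rw [key _ (by omega)]; simp [description, sampleParams]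
  · intro i hi
    rw [key _ (by omega), description, List.getD_append_right _ _ _ _ (by simp [sampleParams])]
    simp only [sampleParams, List.length_cons, List.length_nil, seedTable]
    rw [show 6 + i - (0 + 1 + 1 + 1 + 1 + 1 + 1) = i by omega]
    by_cases h : i < K
    · simp [List.getD, h]
    · simp [List.getD, h]

/-- The sampling program computes the index of the first point of the difference table that
passes the test. -/
lemma runs_sampleProg {w m p K t : ℕ} (inside : ℕ → ℕ → Prop) (hw : K + 8 ≤ 2 ^ w)
    (hp0 : 0 < p) (hp : p < 2 ^ w) (hm0 : 0 < m) (hm : m < 2 ^ w) (ht : 1 ≤ t)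
    (seed : Fin K → Fin p) :
    ∃ T ≤ m * ((4 * K + 4) * t),
      Runs (sampleProg K) inside t (initConfig (description (sampleParams w m p) seed))
        (BitVec.ofNat w (firstHit m fun i =>
          inside (diffTable p (seedTable seed) i 0) (diffTable p (seedTable seed) i 1))) T := by
  obtain ⟨r, rfl⟩ : ∃ r, m = r + 1 := ⟨m - 1, by omega⟩
  refine runs_of_layout hw hp hm ?_ ?_ ht r 0 (by omega) (layout_init hw seed) (by simp)
  · intro i
    unfold seedTable
    split_ifs
    · exact (seed _).2
    · exact hp0
  · intro i hi
    simp [seedTable, hi.not_gt]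

/-! ### Limited independence -/

/-- The variables `X 0, …, X (N - 1)` on the finite probability space `Ω` are uniformly
distributed in `G`, and any `k` of them are independent. -/
def KWiseUniform {Ω G : Type*} [Fintype Ω] [Fintype G] [DecidableEq G] (X : ℕ → Ω → G)
    (N k : ℕ) : Prop :=
  ∀ S ⊆ Finset.range N, S.card ≤ k → ∀ B : ℕ → Finset G,
    ((Finset.univ.filter fun ω => ∀ n ∈ S, X n ω ∈ B n).card : ℝ) =
      Fintype.card Ω * ∏ n ∈ S, ((B n).card / Fintype.card G : ℝ)

/-- If any `k` of the variables together determine the point of a space with `|G| ^ k` points,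
they are `k`-wise independent. -/
lemma kWiseUniform_of_injective {Ω G : Type*} [Fintype Ω] [Fintype G] [DecidableEq G] [Nonempty G]
    (X : ℕ → Ω → G) {N k : ℕ} (hk : k ≤ N) (hcard : Fintype.card Ω = Fintype.card G ^ k)
    (hinj : ∀ S ⊆ Finset.range N, S.card = k → ∀ ω ω', (∀ n ∈ S, X n ω = X n ω') → ω = ω') :
    KWiseUniform X N k := by
  classical
  have hG : (Fintype.card G : ℝ) ≠ 0 := by exact_mod_cast Fintype.card_ne_zero
  -- For exactly `k` indices, injectivity and equal cardinality make evaluation a bijection onto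
  -- G^S, so the count is that of a box.
  have full : ∀ S ⊆ Finset.range N, S.card = k → ∀ B : ℕ → Finset G,
      (Finset.univ.filter fun ω => ∀ n ∈ S, X n ω ∈ B n).card = ∏ n ∈ S, (B n).card := by
    intro S hS hSk B
    have hbij : Function.Bijective (fun (ω : Ω) (n : S) => X n ω) := by
      rw [Fintype.bijective_iff_injective_and_card]
      refine ⟨fun ω ω' h => hinj S hS hSk ω ω' fun n hn => congrFun h ⟨n, hn⟩, ?_⟩
      simp [hcard, hSk]
    rw [← Finset.prod_coe_sort S (fun n => (B n).card), ← Fintype.card_piFinset]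
    refine Finset.card_bij (fun ω _ n => X n ω) ?_ ?_ ?_
    · intro ω hω
      simp only [Finset.mem_filter] at hω
      simp only [Fintype.mem_piFinset]
      exact fun n => hω.2 n n.2
    · intro ω _ ω' _ h
      exact hbij.1 h
    · intro f hf
      obtain ⟨ω, rfl⟩ := hbij.2 f
      simp only [Fintype.mem_piFinset] at hf
      exact ⟨ω, by simpa using fun n hn => hf ⟨n, hn⟩, rfl⟩
  intro S hS hSk B
  -- Fewer indices are padded to `k` of them with vacuous conditions.
  obtain ⟨S', hSS', hS'N, hS'k⟩ := Finset.exists_subsuperset_card_eq hS hSk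
    (by simpa using hk)
  have h := full S' hS'N hS'k (fun n => if n ∈ S then B n else Finset.univ)
  have e1 : (Finset.univ.filter fun ω => ∀ n ∈ S, X n ω ∈ B n) =
      (Finset.univ.filter fun ω => ∀ n ∈ S', X n ω ∈ if n ∈ S then B n else Finset.univ) := by
    ext ω
    simp only [Finset.mem_filter, Finset.mem_univ, true_and]
    constructor
    · intro h n _
      split_ifs with hn
      · exact h n hn
      · simp
    · intro h n hn
      simpa [hn] using h n (hSS' hn)
  rw [e1, h, hcard]
  push_cast
  rw [← hS'k, ← Finset.prod_const, ← Finset.prod_sdiff hSS', ← Finset.prod_sdiff hSS', mul_assoc,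
    ← Finset.prod_mul_distrib]
  congr 1
  · refine Finset.prod_congr rfl fun n hn => ?_
    simp [(Finset.mem_sdiff.1 hn).2]
  · refine Finset.prod_congr rfl fun n hn => ?_
    simp only [hn, if_true]
    field_simp

/-- Pascal's rule: a round applies 1 + E, where E shifts by two, and the binomial theorem expands
the n-th power. Entry i is thus a polynomial in n whose coefficients in the binomial basis are the
seed entries of the same parity. -/
lemma diffTable_cast {p L : ℕ} {d : ℕ → ℕ} (hd : ∀ i, 2 * L ≤ i → d i = 0) (n i : ℕ) :
    (diffTable p d n i : ZMod p) =
      ∑ l ∈ Finset.range L, (n.choose l : ZMod p) * (d (i + 2 * l) : ZMod p) := by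
  -- A vanishing extra term makes room for splitting off l = 0 and shifting the index.
  have ext : ∀ n i : ℕ, ∑ l ∈ Finset.range L, (n.choose l : ZMod p) * (d (i + 2 * l) : ZMod p) =
      ∑ l ∈ Finset.range (L + 1), (n.choose l : ZMod p) * (d (i + 2 * l) : ZMod p) := by
    intro n i
    rw [Finset.sum_range_succ, hd (i + 2 * L) (by omega)]
    simp
  induction n generalizing i with
  | zero =>
    rw [ext, Finset.sum_range_succ']
    simp [diffTable]
  | succ n ih =>
    have h1 := ih i
    have h2 := ih (i + 2)
    rw [ext, Finset.sum_range_succ'] at h1 ⊢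
    simp only [diffTable, ZMod.natCast_mod, Nat.cast_add, h1, h2, Nat.choose_succ_succ, add_mul,
      Finset.sum_add_distrib, Nat.choose_zero_right]
    have : ∀ l, i + 2 * (l + 1) = i + 2 + 2 * l := by intro l; ring
    simp only [this]
    ring

/-- An integer-valued polynomial of degree less than `k`, in the binomial basis, is determined
by its values modulo `p` at `k` points of `{0, …, p - 1}`. -/
lemma binomial_coeff_eq_zero {p k : ℕ} [Fact p.Prime] (hk : k ≤ p) (c : ℕ → ZMod p)
    (S : Finset ℕ) (hS : S ⊆ Finset.range p) (hSk : S.card = k)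
    (h : ∀ n ∈ S, ∑ l ∈ Finset.range k, (n.choose l : ZMod p) * c l = 0) :
    ∀ l < k, c l = 0 := by
  have hfac : ∀ l < k, (l.factorial : ZMod p) ≠ 0 := by
    intro l hl h0
    rw [ZMod.natCast_eq_zero_iff] at h0
    have := ((Fact.out : p.Prime).dvd_factorial).1 h0
    omega
  -- Binomial coefficients are falling factorials over l!, and l! is invertible modulo `p` since l <
  -- k ≤ p. So F has degree below `k` and `k` distinct roots.
  set F : Polynomial (ZMod p) := ∑ l ∈ Finset.range k,
    Polynomial.C (c l / (l.factorial : ZMod p)) * descPochhammer (ZMod p) l with hF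
  have hev : ∀ n : ℕ, F.eval (n : ZMod p) =
      ∑ l ∈ Finset.range k, (n.choose l : ZMod p) * c l := by
    intro n
    rw [hF, Polynomial.eval_finsetSum]
    refine Finset.sum_congr rfl fun l hl => ?_
    have := hfac l (Finset.mem_range.1 hl)
    rw [Polynomial.eval_mul, Polynomial.eval_C, descPochhammer_eval_eq_descFactorial,
      Nat.descFactorial_eq_factorial_mul_choose]
    push_cast
    field_simp
  have hdeg : F.degree < k := by
    rw [hF, ← Polynomial.mem_degreeLT]
    refine Submodule.sum_mem _ fun l hl => Polynomial.mem_degreeLT.2 ?_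
    have hl' := Finset.mem_range.1 hl
    refine Polynomial.degree_le_natDegree.trans_lt ?_
    have h1 := Polynomial.natDegree_C_mul_le (c l / (l.factorial : ZMod p))
      (descPochhammer (ZMod p) l)
    rw [descPochhammer_natDegree] at h1
    exact_mod_cast h1.trans_lt hl'
  have hF0 : F = 0 := by
    refine Polynomial.eq_zero_of_degree_lt_of_eval_finset_eq_zero
      (S.image (Nat.cast : ℕ → ZMod p)) ?_ ?_
    · rw [Finset.card_image_of_injOn, hSk]
      · exact hdeg
      · intro a ha b hb hab
        have ha' := Finset.mem_range.1 (hS ha)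
        have hb' := Finset.mem_range.1 (hS hb)
        have := (ZMod.natCast_eq_natCast_iff' _ _ _).1 hab
        rwa [Nat.mod_eq_of_lt ha', Nat.mod_eq_of_lt hb'] at this
    · intro x hx
      obtain ⟨n, hn, rfl⟩ := Finset.mem_image.1 hx
      rw [hev, h n hn]
  -- The values of F at 0, 1, … form a triangular system: at l the higher binomials vanish, the
  -- lower coefficients by induction.
  intro l
  induction l using Nat.strong_induction_on with
  | _ l ih =>
    intro hl
    have h0 := hev l
    rw [hF0, Polynomial.eval_zero, Finset.sum_eq_single l] at h0
    · simpa using h0.symm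
    · intro b hb hbl
      rcases lt_or_gt_of_ne hbl with hlt | hgt
      · rw [ih b hlt (Finset.mem_range.1 hb), mul_zero]
      · rw [Nat.choose_eq_zero_of_lt hgt]; simp
    · intro h'
      exact absurd (Finset.mem_range.2 hl) h'

lemma seedTable_lt {K p : ℕ} (hp : 0 < p) (seed : Fin K → Fin p) (i : ℕ) :
    seedTable seed i < p := by
  unfold seedTable
  split_ifs
  · exact (seed _).2
  · exact hp

/-- The `n`-th sample point of a seed. -/
def samplePoint {K p : ℕ} [NeZero p] (n : ℕ) (seed : Fin K → Fin p) : Fin p × Fin p :=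
  (⟨diffTable p (seedTable seed) n 0, diffTable_lt (NeZero.pos p) (seedTable_lt (NeZero.pos p) seed) n 0⟩,
    ⟨diffTable p (seedTable seed) n 1, diffTable_lt (NeZero.pos p) (seedTable_lt (NeZero.pos p) seed) n 1⟩)

/-- Even and odd seed entries are the coefficients of the two coordinate polynomials. Each is
determined by `k` values, and there are as many seeds as `k`-tuples of points. -/
lemma samplePoint_kWiseUniform {k p : ℕ} [Fact p.Prime] (hk : k ≤ p) :
    KWiseUniform (samplePoint (K := 2 * k) (p := p)) p k := by
  refine kWiseUniform_of_injective _ hk ?_ ?_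
  · simp only [Fintype.card_fun, Fintype.card_prod, Fintype.card_fin]
    rw [pow_mul, pow_two]
  · intro S hS hSk a b hab
    have hz : ∀ (s : Fin (2 * k) → Fin p) i, 2 * k ≤ i → seedTable s i = 0 := by
      intro s i hi
      simp [seedTable, hi.not_gt]
    have key : ∀ e < 2, ∀ l < k,
        (seedTable a (e + 2 * l) : ZMod p) - (seedTable b (e + 2 * l) : ZMod p) = 0 := by
      intro e he
      refine binomial_coeff_eq_zero hk _ S hS hSk ?_
      intro n hn
      simp only [mul_sub, Finset.sum_sub_distrib]
      rw [← diffTable_cast (hz a), ← diffTable_cast (hz b)]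
      have h := hab n hn
      simp only [samplePoint, Prod.mk.injEq, Fin.mk.injEq] at h
      interval_cases e
      · rw [h.1, sub_self]
      · rw [h.2, sub_self]
    funext ⟨i, hi⟩
    have h := sub_eq_zero.1 (key (i % 2) (Nat.mod_lt _ two_pos) (i / 2) (by omega))
    rw [Nat.mod_add_div, ZMod.natCast_eq_natCast_iff',
      Nat.mod_eq_of_lt (seedTable_lt (NeZero.pos p) _ _),
      Nat.mod_eq_of_lt (seedTable_lt (NeZero.pos p) _ _)] at h
    simpa [seedTable, hi, Fin.ext_iff] using h

/-! ### Truncated inclusion-exclusion -/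

/-- A Bonferroni inequality: for n > 0 the alternating sum is ±C(n - 1, r), and Pascal's rule bounds
this by C(n, r + 1). -/
lemma abs_indicator_sub_alternating_le (n r : ℕ) :
    |(if n = 0 then (1 : ℝ) else 0) -
      ∑ l ∈ Finset.range (r + 1), (-1) ^ l * (n.choose l : ℝ)| ≤ n.choose (r + 1) := by
  cases n with
  | zero =>
    rw [Finset.sum_range_succ']
    simp
  | succ n =>
    have h := Int.alternating_sum_range_choose_eq_choose (n := n) (m := r)
    have h' : ∑ l ∈ Finset.range (r + 1), (-1 : ℝ) ^ l * ((n + 1).choose l : ℝ) =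
        (-1) ^ r * (n.choose r : ℝ) := by exact_mod_cast h
    rw [h', if_neg (by omega), zero_sub, abs_neg, abs_mul, abs_pow, abs_neg, abs_one, one_pow,
      one_mul, Nat.abs_cast, Nat.cast_le, Nat.choose_succ_succ]
    omega

section Sampling

set_option linter.unusedSectionVars false

variable {Ω G : Type*} [Fintype Ω] [Fintype G] [DecidableEq G] {X : ℕ → Ω → G} {N k : ℕ}

/-- The number of hits of `U` among the first `i` samples. -/
def hits (X : ℕ → Ω → G) (U : Finset G) (i : ℕ) (ω : Ω) : ℕ :=
  ((Finset.range i).filter fun n => X n ω ∈ U).card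

lemma hits_eq_zero {U : Finset G} {i : ℕ} {ω : Ω} :
    hits X U i ω = 0 ↔ ∀ n < i, X n ω ∉ U := by
  simp [hits, Finset.filter_eq_empty_iff]

/-- The density of a set. -/
noncomputable def density (U : Finset G) : ℝ := (U.card : ℝ) / Fintype.card G

lemma density_nonneg (U : Finset G) : 0 ≤ density U := by
  unfold density; positivity

lemma density_le_one (U : Finset G) : density U ≤ 1 :=
  div_le_one_of_le₀ (by exact_mod_cast U.card_le_univ) (by positivity)

lemma density_mono {U V : Finset G} (h : U ⊆ V) : density U ≤ density V := by
  unfold density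
  have := Finset.card_le_card h
  gcongr

/-- Factorial moments of the number of hits. -/
lemma sum_choose_hits (hX : KWiseUniform X N k) (B U : Finset G) {i l : ℕ} {S₀ : Finset ℕ}
    (hi : i ≤ N) (hS₀ : S₀ ⊆ Finset.range N) (hdisj : ∀ n ∈ S₀, i ≤ n) (hk : S₀.card + l ≤ k) :
    ∑ ω, (if ∀ n ∈ S₀, X n ω ∈ B then (1 : ℝ) else 0) * ((hits X U i ω).choose l : ℝ) =
      Fintype.card Ω * (density B ^ S₀.card * ((i.choose l : ℝ) * density U ^ l)) := by
  classical
  -- The binomial coefficient counts the l-sets of hitting indices, so its moment is a sum of joint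
  -- probabilities of at most `k` samples.
  have h1 : ∀ ω, (if ∀ n ∈ S₀, X n ω ∈ B then (1 : ℝ) else 0) * ((hits X U i ω).choose l : ℝ) =
      ∑ S ∈ (Finset.range i).powersetCard l,
        if ∀ n ∈ S₀ ∪ S, X n ω ∈ (if n ∈ S₀ then B else U) then (1 : ℝ) else 0 := by
    intro ω
    have hc : (hits X U i ω).choose l =
        (((Finset.range i).powersetCard l).filter fun S => ∀ n ∈ S, X n ω ∈ U).card := by
      rw [hits, ← Finset.card_powersetCard]
      congr 1
      ext S
      simp only [Finset.mem_powersetCard, Finset.mem_filter, Finset.subset_iff]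
      constructor
      · rintro ⟨h, hc⟩
        exact ⟨⟨fun n hn => (h hn).1, hc⟩, fun n hn => (h hn).2⟩
      · rintro ⟨⟨h, hc⟩, h'⟩
        exact ⟨fun n hn => ⟨h hn, h' n hn⟩, hc⟩
    rw [hc, ← Finset.sum_boole, Finset.mul_sum]
    refine Finset.sum_congr rfl fun S hS => ?_
    rw [ite_zero_mul_ite_zero, one_mul]
    refine if_congr ?_ rfl rfl
    have hSi := (Finset.mem_powersetCard.1 hS).1
    constructor
    · rintro ⟨ha, hb⟩ n hn
      split_ifs with h
      · exact ha n h
      · exact hb n ((Finset.mem_union.1 hn).resolve_left h)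
    · intro h
      refine ⟨fun n hn => by simpa [hn] using h n (Finset.mem_union_left _ hn), fun n hn => ?_⟩
      have hn₀ : n ∉ S₀ := fun h0 =>
        absurd (Finset.mem_range.1 (hSi hn)) (hdisj n h0).not_gt
      simpa [hn₀] using h n (Finset.mem_union_right _ hn)
  simp only [h1]
  rw [Finset.sum_comm]
  have h2 : ∀ S ∈ (Finset.range i).powersetCard l,
      (∑ ω, if ∀ n ∈ S₀ ∪ S, X n ω ∈ (if n ∈ S₀ then B else U) then (1 : ℝ) else 0) =
        Fintype.card Ω * (density B ^ S₀.card * density U ^ l) := by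
    intro S hS
    obtain ⟨hSi, hSl⟩ := Finset.mem_powersetCard.1 hS
    have hd : Disjoint S₀ S := by
      rw [Finset.disjoint_left]
      intro n h0 hn
      exact absurd (Finset.mem_range.1 (hSi hn)) (hdisj n h0).not_gt
    rw [Finset.sum_boole, hX (S₀ ∪ S)
      (Finset.union_subset hS₀ (hSi.trans (Finset.range_mono hi)))
      (by rw [Finset.card_union_of_disjoint hd, hSl]; exact hk), Finset.prod_union hd]
    congr 2
    · rw [← Finset.prod_const]
      refine Finset.prod_congr rfl fun n hn => ?_
      simp [hn, density]
    · rw [← hSl, ← Finset.prod_const]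
      refine Finset.prod_congr rfl fun n hn => ?_
      simp [Finset.disjoint_right.1 hd hn, density]
  rw [Finset.sum_congr rfl h2, Finset.sum_const, Finset.card_powersetCard, Finset.card_range,
    nsmul_eq_mul]
  ring

/-- The probability that sample `i` is the first one in `U`, and that it lies in `B`. -/
noncomputable def firstProb (X : ℕ → Ω → G) (U B : Finset G) (i : ℕ) : ℝ :=
  ((Finset.univ.filter fun ω => X i ω ∈ B ∧ ∀ n < i, X n ω ∉ U).card : ℝ) / Fintype.card Ω

/-- The probability that none of the first `i` samples lies in `U`. -/
noncomputable def missProb (X : ℕ → Ω → G) (U : Finset G) (i : ℕ) : ℝ :=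
  ((Finset.univ.filter fun ω => ∀ n < i, X n ω ∉ U).card : ℝ) / Fintype.card Ω

variable [Nonempty Ω]

/-- The indicator of no earlier hit is replaced by its truncated inclusion-exclusion. The error term
involves r + 1 earlier samples together with sample i, whence r + 2 ≤ k. -/
lemma abs_firstProb_sub_le (hX : KWiseUniform X N k) (U B : Finset G) {i r : ℕ} (hi : i < N)
    (hr : r + 2 ≤ k) :
    |firstProb X U B i - density B *
      ∑ l ∈ Finset.range (r + 1), (-1) ^ l * ((i.choose l : ℝ) * density U ^ l)| ≤
      density B * ((i.choose (r + 1) : ℝ) * density U ^ (r + 1)) := by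
  have hΩ : (0 : ℝ) < Fintype.card Ω := by exact_mod_cast Fintype.card_pos
  have hm := fun l (hl : l ≤ r + 1) => sum_choose_hits hX B U (i := i) (l := l) (S₀ := {i}) hi.le
    (by simpa using hi) (by simp) (by simp only [Finset.card_singleton]; omega)
  simp only [Finset.mem_singleton, forall_eq, Finset.card_singleton, pow_one] at hm
  set c : Ω → ℝ := fun ω => if X i ω ∈ B then (1 : ℝ) else 0 with hc
  have hc0 : ∀ ω, 0 ≤ c ω := fun ω => by simp only [hc]; split_ifs <;> simp
  have e1 : ((Finset.univ.filter fun ω => X i ω ∈ B ∧ ∀ n < i, X n ω ∉ U).card : ℝ) =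
      ∑ ω, c ω * (if hits X U i ω = 0 then (1 : ℝ) else 0) := by
    rw [← Finset.sum_boole]
    refine Finset.sum_congr rfl fun ω _ => ?_
    simp only [hc]
    rw [ite_zero_mul_ite_zero, one_mul]
    exact if_congr (and_congr Iff.rfl hits_eq_zero.symm) rfl rfl
  have e2 : Fintype.card Ω * (density B *
      ∑ l ∈ Finset.range (r + 1), (-1) ^ l * ((i.choose l : ℝ) * density U ^ l)) =
      ∑ ω, c ω * ∑ l ∈ Finset.range (r + 1), (-1) ^ l * ((hits X U i ω).choose l : ℝ) := by
    simp only [Finset.mul_sum]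
    rw [Finset.sum_comm]
    refine Finset.sum_congr rfl fun l hl => ?_
    have := hm l (Finset.mem_range.1 hl).le
    calc _ = (-1) ^ l * (Fintype.card Ω * (density B * ((i.choose l : ℝ) * density U ^ l))) := by
          ring
      _ = _ := by
          rw [← this, Finset.mul_sum]
          exact Finset.sum_congr rfl fun ω _ => by ring
  have key : |((Finset.univ.filter fun ω => X i ω ∈ B ∧ ∀ n < i, X n ω ∉ U).card : ℝ) -
      Fintype.card Ω * (density B *
      ∑ l ∈ Finset.range (r + 1), (-1) ^ l * ((i.choose l : ℝ) * density U ^ l))| ≤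
      Fintype.card Ω * (density B * ((i.choose (r + 1) : ℝ) * density U ^ (r + 1))) := by
    rw [e1, e2, ← hm (r + 1) le_rfl, ← Finset.sum_sub_distrib]
    refine (Finset.abs_sum_le_sum_abs _ _).trans (Finset.sum_le_sum fun ω _ => ?_)
    rw [← mul_sub, abs_mul, abs_of_nonneg (hc0 ω)]
    exact mul_le_mul_of_nonneg_left (abs_indicator_sub_alternating_le _ _) (hc0 ω)
  have e3 : firstProb X U B i - density B *
      ∑ l ∈ Finset.range (r + 1), (-1) ^ l * ((i.choose l : ℝ) * density U ^ l) =
      (((Finset.univ.filter fun ω => X i ω ∈ B ∧ ∀ n < i, X n ω ∉ U).card : ℝ) -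
      Fintype.card Ω * (density B *
      ∑ l ∈ Finset.range (r + 1), (-1) ^ l * ((i.choose l : ℝ) * density U ^ l))) /
        Fintype.card Ω := by
    rw [firstProb]
    field_simp
  rw [e3, abs_div, abs_of_pos hΩ, div_le_iff₀ hΩ]
  linarith

/-- Chebyshev's inequality: the number H of hits has mean a and variance at most a, while H = 0
means a deviation of a. -/
lemma missProb_le (hX : KWiseUniform X N k) (hk : 2 ≤ k) (U : Finset G) {M : ℕ} (hM : M ≤ N)
    (hMu : 0 < M * density U) : missProb X U M ≤ 1 / (M * density U) := by
  have hΩ : (0 : ℝ) < Fintype.card Ω := by exact_mod_cast Fintype.card_pos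
  have hm := fun l (hl : l ≤ 2) => sum_choose_hits hX ∅ U (i := M) (l := l) (S₀ := ∅) hM
    (by simp) (by simp) (by simp only [Finset.card_empty]; omega)
  simp only [Finset.notMem_empty, false_imp_iff, implies_true, if_true, one_mul,
    Finset.card_empty, pow_zero] at hm
  set a := M * density U with ha
  have h1 := hm 1 one_le_two
  have h2 := hm 2 le_rfl
  simp only [Nat.choose_one_right, pow_one, ← ha, Nat.cast_choose_two] at h1 h2
  have e1 : ((Finset.univ.filter fun ω => ∀ n < M, X n ω ∉ U).card : ℝ) * a ^ 2 ≤
      Fintype.card Ω * a := by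
    rw [← Finset.sum_boole, Finset.sum_mul]
    -- The summand is (H - a)², written through the factorial moments by H² = 2·C(H, 2) + H.
    calc _ ≤ ∑ ω, (2 * ((hits X U M ω : ℝ) * ((hits X U M ω : ℝ) - 1) / 2) +
            (1 - 2 * a) * (hits X U M ω : ℝ) + a ^ 2) := by
          refine Finset.sum_le_sum fun ω _ => ?_
          split_ifs with h
          · rw [hits_eq_zero.2 h]; simp
          · nlinarith [sq_nonneg ((hits X U M ω : ℝ) - a)]
      _ = 2 * (Fintype.card Ω * ((M : ℝ) * ((M : ℝ) - 1) / 2 * density U ^ 2)) +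
            (1 - 2 * a) * (Fintype.card Ω * a) + Fintype.card Ω * a ^ 2 := by
          rw [Finset.sum_add_distrib, Finset.sum_add_distrib, ← Finset.mul_sum, ← Finset.mul_sum,
            h1, h2]
          simp
      _ = Fintype.card Ω * (a - M * density U ^ 2) := by rw [ha]; ring
      _ ≤ _ := by
          refine mul_le_mul_of_nonneg_left ?_ hΩ.le
          have : 0 ≤ M * density U ^ 2 := by positivity
          linarith
  rw [missProb, div_le_div_iff₀ hΩ hMu]
  nlinarith

lemma missProb_succ (U : Finset G) (i : ℕ) :
    missProb X U i = firstProb X U U i + missProb X U (i + 1) := by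
  classical
  rw [missProb, firstProb, missProb, ← add_div]
  congr 1
  rw [← Nat.cast_add, ← Finset.card_union_of_disjoint]
  · congr 2
    ext ω
    simp only [Finset.mem_filter, Finset.mem_univ, true_and, Finset.mem_union,
      Nat.lt_succ_iff_lt_or_eq]
    constructor
    · intro h
      by_cases hi : X i ω ∈ U
      · exact Or.inl ⟨hi, h⟩
      · refine Or.inr ?_
        rintro n (hn | rfl)
        · exact h n hn
        · exact hi
    · rintro (h | h)
      · exact h.2
      · exact fun n hn => h n (Or.inl hn)
  · rw [Finset.disjoint_left]
    intro ω h1 h2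
    simp only [Finset.mem_filter, Finset.mem_univ, true_and] at h1 h2
    exact h2 i (Nat.lt_succ_self i) h1.1

lemma sum_firstProb (U : Finset G) (M : ℕ) :
    ∑ i ∈ Finset.range M, firstProb X U U i = 1 - missProb X U M := by
  induction M with
  | zero => simp [missProb]
  | succ M ih =>
    rw [Finset.sum_range_succ, ih, missProb_succ (X := X) U M]
    ring

lemma missProb_nonneg (U : Finset G) (M : ℕ) : 0 ≤ missProb X U M := by
  unfold missProb; positivity

/-- With q and u the densities of B and U, the two first-hit probabilities are close to qT and uT
with the same sum T. Hence T cancels without being evaluated, and the probabilities for U add up to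
1 minus the miss probability. -/
lemma abs_sum_firstProb_sub_le (hX : KWiseUniform X N k) {U B : Finset G} (hBU : B ⊆ U)
    (hU : 0 < density U) {M r : ℕ} (hM : M ≤ N) (hr : r + 2 ≤ k) :
    |∑ i ∈ Finset.range M, firstProb X U B i -
        density B / density U * (1 - missProb X U M)| ≤
      2 * ((M * density U) ^ (r + 2) / (r + 1).factorial) := by
  have hq := density_mono hBU
  have hq0 := density_nonneg B
  set u := density U
  set q := density B
  have term : ∀ i ∈ Finset.range M, |firstProb X U B i - q / u * firstProb X U U i| ≤
      2 * (u * ((M * u) ^ (r + 1) / (r + 1).factorial)) := by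
    intro i hi
    have hiM := Finset.mem_range.1 hi
    have h1 := abs_firstProb_sub_le hX U B (hiM.trans_le hM) hr
    have h2 := abs_firstProb_sub_le hX U U (hiM.trans_le hM) hr
    set T := ∑ l ∈ Finset.range (r + 1), (-1) ^ l * ((i.choose l : ℝ) * u ^ l)
    have hqu : 0 ≤ q / u := by positivity
    have h3 : |q / u * (firstProb X U U i - u * T)| ≤
        q * ((i.choose (r + 1) : ℝ) * u ^ (r + 1)) := by
      rw [abs_mul, abs_of_nonneg hqu]
      refine (mul_le_mul_of_nonneg_left h2 hqu).trans (le_of_eq ?_)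
      change q / u * (u * ((i.choose (r + 1) : ℝ) * u ^ (r + 1))) = _
      field_simp
    have h4 : firstProb X U B i - q / u * firstProb X U U i =
        (firstProb X U B i - q * T) - q / u * (firstProb X U U i - u * T) := by
      field_simp
      ring
    have h5 : (i.choose (r + 1) : ℝ) * u ^ (r + 1) ≤ (M * u) ^ (r + 1) / (r + 1).factorial := by
      have hc := Nat.choose_le_pow_div (α := ℝ) (r + 1) i
      rw [mul_pow, mul_div_right_comm]
      refine mul_le_mul_of_nonneg_right (hc.trans ?_) (by positivity)
      gcongr
    rw [h4]
    calc _ ≤ _ := abs_sub _ _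
      _ ≤ q * ((i.choose (r + 1) : ℝ) * u ^ (r + 1)) +
          q * ((i.choose (r + 1) : ℝ) * u ^ (r + 1)) := add_le_add h1 h3
      _ = 2 * (q * ((i.choose (r + 1) : ℝ) * u ^ (r + 1))) := by ring
      _ ≤ _ := by gcongr
  rw [← sum_firstProb, Finset.mul_sum, ← Finset.sum_sub_distrib]
  refine (Finset.abs_sum_le_sum_abs _ _).trans ((Finset.sum_le_sum term).trans (le_of_eq ?_))
  rw [Finset.sum_const, Finset.card_range, nsmul_eq_mul]
  ring

/-! ### The collision probability of first hits -/

lemma firstHit_eq_firstHit_of_common {s s' : ℕ → Prop} {m i : ℕ} (hi : i ≤ m) (h : s i) (h' : s' i)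
    (hlt : ∀ n < i, ¬ s n ∧ ¬ s' n) : firstHit m s = firstHit m s' := by
  rw [firstHit_eq hi (Or.inr h) fun n hn => (hlt n hn).1,
    firstHit_eq hi (Or.inr h') fun n hn => (hlt n hn).2]

/-- If the first hit of the union comes before `M`, the indices agree exactly when it lies in the
intersection. Otherwise the event is charged to the miss probability. `M` serves the analysis only
and may be far below the cutoff `m`. -/
lemma abs_collision_sub_le (hX : KWiseUniform X N k) (A₁ A₂ : Finset G)
    (hU : 0 < density (A₁ ∪ A₂)) {M m r : ℕ} (hM : M ≤ N) (hm : M ≤ m) (hr : r + 2 ≤ k) :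
    |((Nat.card {ω // firstHit m (fun n => X n ω ∈ A₁) = firstHit m (fun n => X n ω ∈ A₂)} : ℕ) : ℝ)
        / Fintype.card Ω - density (A₁ ∩ A₂) / density (A₁ ∪ A₂)| ≤
      missProb X (A₁ ∪ A₂) M +
        2 * ((M * density (A₁ ∪ A₂)) ^ (r + 2) / (r + 1).factorial) := by
  classical
  have hΩ : (0 : ℝ) < Fintype.card Ω := by exact_mod_cast Fintype.card_pos
  set U := A₁ ∪ A₂ with hUdef
  set B := A₁ ∩ A₂ with hBdef
  have hBU : B ⊆ U := Finset.inter_subset_left.trans Finset.subset_union_left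
  have herr := abs_le.1 (abs_sum_firstProb_sub_le hX hBU hU hM hr)
  have hmiss := missProb_nonneg (X := X) U M
  set C := Finset.univ.filter fun ω =>
    firstHit m (fun n => X n ω ∈ A₁) = firstHit m (fun n => X n ω ∈ A₂) with hC
  have hcard : Nat.card {ω // firstHit m (fun n => X n ω ∈ A₁) =
      firstHit m (fun n => X n ω ∈ A₂)} = C.card := by
    rw [Nat.card_eq_fintype_card, Fintype.card_subtype]
  set E : ℕ → Finset Ω := fun i =>
    Finset.univ.filter fun ω => X i ω ∈ B ∧ ∀ n < i, X n ω ∉ U with hE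
  set Z := Finset.univ.filter fun ω => ∀ n < M, X n ω ∉ U with hZ
  have hsum : (((Finset.range M).biUnion E).card : ℝ) / Fintype.card Ω =
      ∑ i ∈ Finset.range M, firstProb X U B i := by
    rw [Finset.card_biUnion]
    · push_cast
      rw [Finset.sum_div]
      rfl
    · intro i _ j _ hij
      rw [Function.onFun, Finset.disjoint_left]
      intro ω h1 h2
      simp only [hE, Finset.mem_filter, Finset.mem_univ, true_and] at h1 h2
      rcases lt_or_gt_of_ne hij with h | h
      · exact h2.2 i h (hBU h1.1)
      · exact h1.2 j h (hBU h2.1)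
  have hlow : (Finset.range M).biUnion E ⊆ C := by
    intro ω hω
    obtain ⟨i, hi, hω⟩ := Finset.mem_biUnion.1 hω
    simp only [hE, Finset.mem_filter, Finset.mem_univ, true_and] at hω
    simp only [hC, Finset.mem_filter, Finset.mem_univ, true_and]
    refine firstHit_eq_firstHit_of_common ((Finset.mem_range.1 hi).le.trans hm)
      (Finset.mem_inter.1 hω.1).1 (Finset.mem_inter.1 hω.1).2 fun n hn => ?_
    exact ⟨fun h => hω.2 n hn (Finset.mem_union_left _ h),
      fun h => hω.2 n hn (Finset.mem_union_right _ h)⟩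
  have hup : C ⊆ (Finset.range M).biUnion E ∪ Z := by
    intro ω hω
    simp only [hC, Finset.mem_filter, Finset.mem_univ, true_and] at hω
    have hno₁ := fun n (hn : n < _) => not_of_lt_firstHit (m := m) (s := fun n => X n ω ∈ A₁) hn
    have hno₂ := fun n (hn : n < _) => not_of_lt_firstHit (m := m) (s := fun n => X n ω ∈ A₂) hn
    have hmem₁ := firstHit_mem m (fun n => X n ω ∈ A₁)
    have hmem₂ := firstHit_mem m (fun n => X n ω ∈ A₂)
    rw [← hω] at hno₂ hmem₂
    set i := firstHit m (fun n => X n ω ∈ A₁)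
    have hno : ∀ n < i, X n ω ∉ U := fun n hn h =>
      (Finset.mem_union.1 h).elim (hno₁ n hn) (hno₂ n hn)
    by_cases hi : i < M
    · refine Finset.mem_union_left _ (Finset.mem_biUnion.2 ⟨i, Finset.mem_range.2 hi, ?_⟩)
      simp only [hE, Finset.mem_filter, Finset.mem_univ, true_and]
      exact ⟨Finset.mem_inter.2 ⟨hmem₁.resolve_left (by omega), hmem₂.resolve_left (by omega)⟩,
        hno⟩
    · refine Finset.mem_union_right _ ?_
      simp only [hZ, Finset.mem_filter, Finset.mem_univ, true_and]
      exact fun n hn => hno n (by omega)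
  have h1 : ∑ i ∈ Finset.range M, firstProb X U B i ≤ (C.card : ℝ) / Fintype.card Ω := by
    rw [← hsum]
    have := Finset.card_le_card hlow
    gcongr
  have h2 : (C.card : ℝ) / Fintype.card Ω ≤
      ∑ i ∈ Finset.range M, firstProb X U B i + missProb X U M := by
    rw [← hsum, missProb, ← add_div]
    have := (Finset.card_le_card hup).trans (Finset.card_union_le _ _)
    gcongr
    exact_mod_cast this
  -- The term (q/u) · `missProb` appears only in the lower bound and a further `missProb` only in
  -- the upper one, so a single `missProb` covers both sides.
  have hqu : density B / density U ≤ 1 := div_le_one_of_le₀ (density_mono hBU) hU.le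
  have hqu0 : 0 ≤ density B / density U := div_nonneg (density_nonneg _) hU.le
  rw [hcard, abs_le]
  constructor <;> nlinarith [herr.1, herr.2]

end Sampling

/-- Sampling `k`-wise independent points until the first hit has a collision probability that
is within `ε` of the Jaccard similarity. -/
theorem exists_collision_approx {ε : ℝ} (hε : 0 < ε) :
    ∃ (k : ℕ) (c : ℝ), 0 < c ∧
      ∀ {Ω G : Type} [Fintype Ω] [Nonempty Ω] [Fintype G] [DecidableEq G] {X : ℕ → Ω → G} {N m : ℕ}
        {δ : ℝ}, KWiseUniform X N k → ∀ A₁ A₂ : Finset G, 0 < δ → δ ≤ density (A₁ ∪ A₂) →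
        m ≤ N → c / δ ≤ m →
        |((Nat.card {ω // firstHit m (fun n => X n ω ∈ A₁) =
            firstHit m (fun n => X n ω ∈ A₂)} : ℕ) : ℝ) / Fintype.card Ω -
          density (A₁ ∩ A₂) / density (A₁ ∪ A₂)| ≤ ε := by
  -- The truncation error for M·u ≤ 2/ε + 1; factorials outgrow powers.
  obtain ⟨r, hr⟩ : ∃ r : ℕ,
      2 * ((2 / ε + 1) * ((2 / ε + 1) ^ (r + 1) / (r + 1).factorial)) < ε / 2 := by
    have h := ((FloorSemiring.tendsto_pow_div_factorial_atTop (2 / ε + 1)).const_mul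
      (2 / ε + 1)).const_mul 2
    simp only [mul_zero] at h
    exact ((Filter.tendsto_add_atTop_iff_nat 1).2 h |>.eventually_lt_const (half_pos hε)).exists
  refine ⟨r + 2, 2 / ε, by positivity, ?_⟩
  intro Ω G _ _ _ _ X N m δ hX A₁ A₂ hδ hδu hmN hm
  have hu : 0 < density (A₁ ∪ A₂) := hδ.trans_le hδu
  have hu1 := density_le_one (A₁ ∪ A₂)
  -- `M` is tuned to the actual density u, not to its lower bound δ. This keeps M·u between 2/ε and
  -- 2/ε + 1, so `r` and `k` depend on ε alone.
  have hMm : ⌈2 / ε / density (A₁ ∪ A₂)⌉₊ ≤ m := by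
    rw [Nat.ceil_le]
    refine le_trans ?_ hm
    gcongr
  have key := abs_collision_sub_le hX A₁ A₂ hu (hMm.trans hmN) hMm (r := r) le_rfl
  have hM1 := Nat.le_ceil (2 / ε / density (A₁ ∪ A₂))
  have hM2 := Nat.ceil_lt_add_one (a := 2 / ε / density (A₁ ∪ A₂)) (by positivity)
  set M := ⌈2 / ε / density (A₁ ∪ A₂)⌉₊
  set u := density (A₁ ∪ A₂)
  have hlow : 2 / ε ≤ M * u := by
    rwa [div_le_iff₀ hu] at hM1
  have hhigh : M * u ≤ 2 / ε + 1 := by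
    have : (M : ℝ) * u ≤ (2 / ε / u + 1) * u := by gcongr
    rw [add_mul, div_mul_cancel₀ _ hu.ne'] at this
    linarith
  have hpos : 0 < M * u := lt_of_lt_of_le (by positivity) hlow
  have hmiss := missProb_le hX (by omega) (A₁ ∪ A₂) (hMm.trans hmN) hpos
  have hmiss2 : 1 / (M * u) ≤ ε / 2 := by
    rw [div_le_iff₀ hpos]
    calc 1 = ε / 2 * (2 / ε) := by field_simp
      _ ≤ _ := by gcongr
  have herr : 2 * ((M * u) ^ (r + 2) / (r + 1).factorial) ≤ ε / 2 := by
    refine le_trans ?_ hr.le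
    rw [← mul_div_assoc (2 / ε + 1), ← pow_succ']
    gcongr
  calc _ ≤ _ := key
    _ ≤ ε / 2 + ε / 2 := add_le_add (hmiss.trans hmiss2) herr
    _ = ε := by ring

/-! ### Coordinates with respect to a square grid -/

lemma rot_apply_zero (v : Plane) : rot v 0 = -(v 1) := by simp [rot]

lemma rot_apply_one (v : Plane) : rot v 1 = v 0 := by simp [rot]

lemma rot_smul (c : ℝ) (v : Plane) : rot (c • v) = c • rot v := by
  ext i
  fin_cases i <;> simp [rot]

lemma plane_inner (x y : Plane) : inner ℝ x y = x 0 * y 0 + x 1 * y 1 := by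
  simp only [PiLp.inner_apply, Fin.sum_univ_two, RCLike.inner_apply, conj_trivial]
  ring

lemma plane_norm_sq (x : Plane) : ‖x‖ ^ 2 = x 0 ^ 2 + x 1 ^ 2 := by
  rw [← real_inner_self_eq_norm_sq, plane_inner]
  ring

lemma norm_rot (v : Plane) : ‖rot v‖ = ‖v‖ := by
  rw [← sq_eq_sq₀ (norm_nonneg _) (norm_nonneg _), plane_norm_sq, plane_norm_sq, rot_apply_zero,
    rot_apply_one]
  ring

/-- The coordinate of `z` along `v`, in units of `v`. -/
noncomputable def coord (v z : Plane) : ℝ := inner ℝ v z / ‖v‖ ^ 2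

lemma coord_add (v z z' : Plane) : coord v (z + z') = coord v z + coord v z' := by
  simp [coord, inner_add_right, add_div]

lemma coord_smul (v z : Plane) (c : ℝ) : coord v (c • z) = c * coord v z := by
  simp [coord, inner_smul_right, mul_div_assoc]

lemma coord_self {v : Plane} (hv : v ≠ 0) : coord v v = 1 := by
  have : ‖v‖ ≠ 0 := norm_ne_zero_iff.2 hv
  rw [coord, real_inner_self_eq_norm_sq]
  field_simp

lemma coord_rot (v : Plane) : coord v (rot v) = 0 := by
  rw [coord, plane_inner, rot_apply_zero, rot_apply_one]
  ring

lemma coord_rot_left (v : Plane) : coord (rot v) v = 0 := by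
  rw [coord, plane_inner, rot_apply_zero, rot_apply_one]
  ring

lemma rot_ne_zero {v : Plane} (hv : v ≠ 0) : rot v ≠ 0 := by
  rw [← norm_ne_zero_iff, norm_rot]
  exact norm_ne_zero_iff.2 hv

lemma coord_comb {v : Plane} (hv : v ≠ 0) (a b : ℝ) : coord v (a • v + b • rot v) = a := by
  rw [coord_add, coord_smul, coord_smul, coord_self hv, coord_rot]
  ring

lemma coord_rot_comb {v : Plane} (hv : v ≠ 0) (a b : ℝ) :
    coord (rot v) (a • v + b • rot v) = b := by
  rw [coord_add, coord_smul, coord_smul, coord_self (rot_ne_zero hv), coord_rot_left]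
  ring

lemma eq_comb_coord {v : Plane} (hv : v ≠ 0) (z : Plane) :
    z = coord v z • v + coord (rot v) z • rot v := by
  have h : v 0 ^ 2 + v 1 ^ 2 ≠ 0 := by
    rw [← plane_norm_sq]
    exact pow_ne_zero 2 (norm_ne_zero_iff.2 hv)
  ext i
  fin_cases i
  · simp only [coord, norm_rot, plane_inner, plane_norm_sq, rot_apply_zero, rot_apply_one,
      Fin.zero_eta, PiLp.add_apply, PiLp.smul_apply, smul_eq_mul]
    field_simp
    ring
  · simp only [coord, norm_rot, plane_inner, plane_norm_sq, rot_apply_zero, rot_apply_one,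
      Fin.mk_one, PiLp.add_apply, PiLp.smul_apply, smul_eq_mul]
    field_simp
    ring

lemma abs_coord_le {v : Plane} (hv : v ≠ 0) (z : Plane) : |coord v z| ≤ ‖z‖ / ‖v‖ := by
  have h : 0 < ‖v‖ := norm_pos_iff.2 hv
  rw [coord, abs_div, abs_of_pos (pow_pos h 2), div_le_div_iff₀ (pow_pos h 2) h]
  nlinarith [abs_real_inner_le_norm v z]

lemma norm_comb_le (v : Plane) (a b : ℝ) : ‖a • v + b • rot v‖ ≤ (|a| + |b|) * ‖v‖ := by
  refine (norm_add_le _ _).trans (le_of_eq ?_)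
  rw [norm_smul, norm_smul, norm_rot, Real.norm_eq_abs, Real.norm_eq_abs]
  ring

lemma ball_subset_square {o u : Plane} (hu : u ≠ 0) :
    Metric.ball (o + (1 / 2 : ℝ) • u + (1 / 2 : ℝ) • rot u) (‖u‖ / 2) ⊆ square o u := by
  intro x hx
  rw [Metric.mem_ball, dist_eq_norm] at hx
  set z := x - (o + (1 / 2 : ℝ) • u + (1 / 2 : ℝ) • rot u) with hz
  have hpos : 0 < ‖u‖ := norm_pos_iff.2 hu
  have h1 : |coord u z| ≤ 1 / 2 := (abs_coord_le hu z).trans (by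
    rw [div_le_iff₀ hpos]; linarith)
  have h2 : |coord (rot u) z| ≤ 1 / 2 := (abs_coord_le (rot_ne_zero hu) z).trans (by
    rw [norm_rot, div_le_iff₀ hpos]; linarith)
  rw [abs_le] at h1 h2
  refine ⟨1 / 2 + coord u z, ⟨by linarith, by linarith⟩, 1 / 2 + coord (rot u) z,
    ⟨by linarith, by linarith⟩, ?_⟩
  have hx' : x = z + (o + (1 / 2 : ℝ) • u + (1 / 2 : ℝ) • rot u) := by rw [hz]; abel
  have he := eq_comb_coord hu z
  generalize coord u z = a at *
  generalize coord (rot u) z = b at *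
  rw [hx', he, add_smul, add_smul]
  abel

/-! ### Grid cells -/

/-- The half-open grid cell with corner `gridPoint o v i j`. -/
def cell (o v : Plane) (i j : ℕ) : Set Plane :=
  {x | ⌊coord v (x - o)⌋ = i ∧ ⌊coord (rot v) (x - o)⌋ = j}

lemma measurableSet_cell (o v : Plane) (i j : ℕ) : MeasurableSet (cell o v i j) := by
  have h : ∀ v : Plane, Measurable fun x : Plane => ⌊coord v (x - o)⌋ := by
    intro v
    refine Int.measurable_floor.comp (Continuous.measurable ?_)
    unfold coord
    fun_prop
  exact (h v (measurableSet_singleton _)).inter (h (rot v) (measurableSet_singleton _))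

lemma sub_gridPoint (o v : Plane) (i j : ℕ) (x : Plane) :
    x - o = (x - gridPoint o v i j) + ((i : ℝ) • v + (j : ℝ) • rot v) := by
  rw [gridPoint]; abel

lemma dist_gridPoint_le {o v : Plane} (hv : v ≠ 0) {i j : ℕ} {x : Plane} (hx : x ∈ cell o v i j) :
    dist x (gridPoint o v i j) ≤ 2 * ‖v‖ := by
  rw [dist_eq_norm]
  obtain ⟨h1, h2⟩ := hx
  rw [sub_gridPoint o v i j x, coord_add, coord_comb hv, Int.floor_eq_iff] at h1
  rw [sub_gridPoint o v i j x, coord_add, coord_rot_comb hv, Int.floor_eq_iff] at h2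
  set z := x - gridPoint o v i j
  push_cast at h1 h2
  rw [eq_comb_coord hv z]
  refine (norm_comb_le _ _ _).trans (mul_le_mul_of_nonneg_right ?_ (norm_nonneg _))
  rw [abs_of_nonneg (by linarith), abs_of_nonneg (by linarith)]
  linarith

/-- The half-open cells extend one step beyond the last grid points, so those with corners in the
grid also cover the far edges. -/
lemma exists_mem_cell {o v : Plane} (hv : v ≠ 0) {p : ℕ} (hp : 0 < p) {x : Plane}
    (hx : x ∈ square o (((p : ℝ) - 1) • v)) : ∃ i < p, ∃ j < p, x ∈ cell o v i j := by
  obtain ⟨a, ha, b, hb, rfl⟩ := hx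
  have hp1 : (1 : ℝ) ≤ p := by exact_mod_cast hp
  have e : o + a • ((p : ℝ) - 1) • v + b • rot (((p : ℝ) - 1) • v) - o =
      (a * ((p : ℝ) - 1)) • v + (b * ((p : ℝ) - 1)) • rot v := by
    rw [rot_smul, smul_smul, smul_smul]; abel
  have key : ∀ a ∈ Icc (0 : ℝ) 1, ⌊a * ((p : ℝ) - 1)⌋₊ < p ∧
      ⌊a * ((p : ℝ) - 1)⌋ = (⌊a * ((p : ℝ) - 1)⌋₊ : ℤ) := by
    intro a ha
    have h0 : 0 ≤ a * ((p : ℝ) - 1) := mul_nonneg ha.1 (by linarith)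
    refine ⟨?_, (Int.natCast_floor_eq_floor h0).symm⟩
    rw [Nat.floor_lt h0]
    nlinarith [ha.2]
  refine ⟨_, (key a ha).1, _, (key b hb).1, ?_, ?_⟩
  · rw [e, coord_comb hv, (key a ha).2]
  · rw [e, coord_rot_comb hv, (key b hb).2]

lemma volume_cell {o v : Plane} (hv : v ≠ 0) (i j : ℕ) :
    volume (cell o v i j) = volume (cell o v 0 0) := by
  have : cell o v i j = (fun x => x + -((i : ℝ) • v + (j : ℝ) • rot v)) ⁻¹' cell o v 0 0 := by
    ext x
    have e : x + -((i : ℝ) • v + (j : ℝ) • rot v) - o = x - gridPoint o v i j := by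
      rw [gridPoint]; abel
    simp only [cell, mem_preimage, mem_ofPred_eq, e]
    rw [sub_gridPoint o v i j x, coord_add, coord_comb hv, coord_add, coord_rot_comb hv,
      Int.floor_add_natCast, Int.floor_add_natCast]
    simp
  rw [this, measure_preimage_add_right]

lemma volume_cell_pos {o v : Plane} (hv : v ≠ 0) : 0 < volume (cell o v 0 0) := by
  have hn : 0 < ‖v‖ := norm_pos_iff.2 hv
  have hsub : Metric.ball (o + (1 / 2 : ℝ) • v + (1 / 2 : ℝ) • rot v) (‖v‖ / 2) ⊆
      cell o v 0 0 := by
    intro x hx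
    rw [Metric.mem_ball, dist_eq_norm] at hx
    set z := x - (o + (1 / 2 : ℝ) • v + (1 / 2 : ℝ) • rot v) with hz
    have h1 : |coord v z| < 1 / 2 := (abs_coord_le hv z).trans_lt (by
      rw [div_lt_iff₀ hn]; linarith)
    have h2 : |coord (rot v) z| < 1 / 2 := (abs_coord_le (rot_ne_zero hv) z).trans_lt (by
      rw [norm_rot, div_lt_iff₀ hn]; linarith)
    have e : x - o = z + ((1 / 2 : ℝ) • v + (1 / 2 : ℝ) • rot v) := by rw [hz]; abel
    rw [abs_lt] at h1 h2
    constructor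
    · rw [e, coord_add, coord_comb hv, Int.floor_eq_iff]
      push_cast
      constructor <;> linarith
    · rw [e, coord_add, coord_rot_comb hv, Int.floor_eq_iff]
      push_cast
      constructor <;> linarith
  exact (Metric.measure_ball_pos volume _ (half_pos hn)).trans_le (measure_mono hsub)

lemma volume_cell_lt_top {o v : Plane} (hv : v ≠ 0) : volume (cell o v 0 0) < ⊤ := by
  refine (measure_mono (t := Metric.closedBall (gridPoint o v 0 0) (2 * ‖v‖)) ?_).trans_lt
    measure_closedBall_lt_top
  exact fun x hx => dist_gridPoint_le hv hx

lemma area_cell_pos {o v : Plane} (hv : v ≠ 0) : 0 < area (cell o v 0 0) :=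
  ENNReal.toReal_pos (volume_cell_pos hv).ne' (volume_cell_lt_top hv).ne

lemma volume_cells {o v : Plane} (hv : v ≠ 0) {p : ℕ} (F : Finset (Fin p × Fin p)) :
    volume (⋃ g ∈ F, cell o v g.1 g.2) = F.card * volume (cell o v 0 0) := by
  rw [measure_biUnion_finset]
  · rw [Finset.sum_congr rfl fun g _ => volume_cell (o := o) hv g.1 g.2, Finset.sum_const,
      nsmul_eq_mul]
  · intro g _ g' _ hg
    rw [Function.onFun, Set.disjoint_left]
    rintro x ⟨h1, h2⟩ ⟨h3, h4⟩
    rw [h1] at h3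
    rw [h2] at h4
    exact hg (Prod.ext (Fin.ext (by exact_mod_cast h3)) (Fin.ext (by exact_mod_cast h4)))
  · exact fun g _ => measurableSet_cell _ _ _ _

lemma area_le_of_subset_cells {o v : Plane} (hv : v ≠ 0) {p : ℕ} {F : Finset (Fin p × Fin p)}
    {S : Set Plane} (h : S ⊆ ⋃ g ∈ F, cell o v g.1 g.2) :
    area S ≤ F.card * area (cell o v 0 0) := by
  have hle := (measure_mono (μ := volume) h).trans (volume_cells hv F).le
  have := ENNReal.toReal_mono (ENNReal.mul_ne_top (by simp) (volume_cell_lt_top hv).ne) hle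
  simpa [area] using this

lemma le_area_of_cells_subset {o v : Plane} (hv : v ≠ 0) {p : ℕ} {F : Finset (Fin p × Fin p)}
    {S : Set Plane} (h : (⋃ g ∈ F, cell o v g.1 g.2) ⊆ S) (hS : volume S ≠ ⊤) :
    F.card * area (cell o v 0 0) ≤ area S := by
  have hle := (volume_cells hv F).ge.trans (measure_mono (μ := volume) h)
  simpa [area] using ENNReal.toReal_mono hS hle

/-! ### Inner and outer ranges -/

lemma innerRange_subset {P : Set Plane} (hP : IsClosed P) {r : ℝ} (hr : 0 ≤ r) :
    innerRange P r ⊆ P := by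
  intro x hx
  by_contra hxP
  refine hx ⟨x, ?_, by simpa using hr⟩
  rwa [hP.isOpen_compl.interior_eq]

/-- The strict inequality leaves room to move x into the interior, which is dense in P. -/
lemma mem_outerRange_of_dist_lt {P : Set Plane} (hP : IsPolygon P) {x g : Plane} {r : ℝ}
    (hx : x ∈ P) (h : dist g x < r) : g ∈ outerRange P r := by
  rw [← hP.regular] at hx
  obtain ⟨y, hy, hxy⟩ := Metric.mem_closure_iff.1 hx (r - dist g x) (by linarith)
  exact ⟨y, hy, (dist_triangle g x y).trans (by linarith)⟩

lemma mem_outerRange_of_dist_le {P : Set Plane} {x g : Plane} {r s r' : ℝ}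
    (hg : g ∈ outerRange P r) (h : dist x g ≤ s) (hr : s + r ≤ r') : x ∈ outerRange P r' := by
  obtain ⟨y, hy, hgy⟩ := hg
  exact ⟨y, hy, (dist_triangle x g y).trans (by linarith)⟩

lemma outerRange_subset_closedBall {P : Set Plane} (hP : IsPolygon P) {y : Plane} (hy : y ∈ P)
    (r : ℝ) : outerRange P r ⊆ Metric.closedBall y (Metric.diam P + r) := by
  rintro x ⟨z, hz, hxz⟩
  have := Metric.dist_le_diam_of_mem hP.compact.isBounded (interior_subset hz) hy
  exact (dist_triangle x z y).trans (by linarith)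

lemma volume_outerRange_ne_top {P : Set Plane} (hP : IsPolygon P) (r : ℝ) :
    volume (outerRange P r) ≠ ⊤ := by
  obtain ⟨y, hy⟩ := hP.nonempty
  exact ((measure_mono (outerRange_subset_closedBall hP hy r)).trans_lt
    measure_closedBall_lt_top).ne

open Classical in
/-- The points of the `p × p` grid in a set. -/
noncomputable def gridFinset (o v : Plane) (p : ℕ) (Q : Set Plane) : Finset (Fin p × Fin p) :=
  Finset.univ.filter fun g => gridPoint o v g.1 g.2 ∈ Q

lemma mem_gridFinset {o v : Plane} {p : ℕ} {Q : Set Plane} {g : Fin p × Fin p} :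
    g ∈ gridFinset o v p Q ↔ gridPoint o v g.1 g.2 ∈ Q := by
  simp [gridFinset]

/-- The Jaccard similarity of the grid points in the half ranges is valid. -/
lemma isValidJaccard_grid {φ : ℝ} {o v : Plane} (hv : v ≠ 0) {p : ℕ} (hp : 0 < p)
    {P₁ P₂ : Set Plane} (hP₁ : IsPolygon P₁) (hP₂ : IsPolygon P₂)
    (hs₁ : P₁ ⊆ square o (((p : ℝ) - 1) • v)) (hs₂ : P₂ ⊆ square o (((p : ℝ) - 1) • v))
    (hw₁ : 4 * ‖v‖ < fuzzWidth φ P₁) (hw₂ : 4 * ‖v‖ < fuzzWidth φ P₂)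
    {F₁ F₂ : Finset (Fin p × Fin p)}
    (hF₁ : F₁ = gridFinset o v p (outerRange P₁ (fuzzWidth φ P₁ / 2)))
    (hF₂ : F₂ = gridFinset o v p (outerRange P₂ (fuzzWidth φ P₂ / 2)))
    (hne : (F₁ ∪ F₂).Nonempty) :
    IsValidJaccard φ P₁ P₂ (density (F₁ ∩ F₂) / density (F₁ ∪ F₂)) := by
  have hV := area_cell_pos (o := o) hv
  have hnv : 0 ≤ ‖v‖ := norm_nonneg v
  have hcard : (0 : ℝ) < (F₁ ∪ F₂).card := by exact_mod_cast hne.card_pos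
  have lower : ∀ {P : Set Plane}, IsPolygon P → P ⊆ square o (((p : ℝ) - 1) • v) →
      4 * ‖v‖ < fuzzWidth φ P → ∀ x ∈ innerRange P (fuzzWidth φ P), x ∈ P ∧
        ∀ g : Fin p × Fin p, x ∈ cell o v g.1 g.2 →
          g ∈ gridFinset o v p (outerRange P (fuzzWidth φ P / 2)) := by
    intro P hP hs hw x hx
    have hxP := innerRange_subset hP.compact.isClosed (by linarith) hx
    refine ⟨hxP, fun g hg => mem_gridFinset.2 (mem_outerRange_of_dist_lt hP hxP ?_)⟩
    rw [dist_comm]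
    exact (dist_gridPoint_le hv hg).trans_lt (by linarith)
  have upper : ∀ {P : Set Plane}, 4 * ‖v‖ < fuzzWidth φ P →
      ∀ g ∈ gridFinset o v p (outerRange P (fuzzWidth φ P / 2)), ∀ x ∈ cell o v g.1 g.2,
        x ∈ outerRange P (fuzzWidth φ P) := by
    intro P hw g hg x hx
    exact mem_outerRange_of_dist_le (mem_gridFinset.1 hg) (dist_gridPoint_le hv hx) (by linarith)
  have hcell : ∀ {x}, x ∈ square o (((p : ℝ) - 1) • v) →
      ∃ g : Fin p × Fin p, x ∈ cell o v g.1 g.2 := by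
    intro x hx
    obtain ⟨i, hi, j, hj, h⟩ := exists_mem_cell hv hp hx
    exact ⟨(⟨i, hi⟩, ⟨j, hj⟩), h⟩
  -- The witnesses are the areas of the cells over the common and over all hit grid points; `lower`
  -- and `upper` place these cells between the inner and outer ranges.
  refine ⟨(F₁ ∩ F₂).card * area (cell o v 0 0), (F₁ ∪ F₂).card * area (cell o v 0 0),
    area_le_of_subset_cells hv ?_, le_area_of_cells_subset hv ?_ ?_,
    area_le_of_subset_cells hv ?_, le_area_of_cells_subset hv ?_ ?_, by positivity, ?_⟩
  · rintro x ⟨h1, h2⟩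
    obtain ⟨hxP, m1⟩ := lower hP₁ hs₁ hw₁ x h1
    obtain ⟨-, m2⟩ := lower hP₂ hs₂ hw₂ x h2
    obtain ⟨g, hg⟩ := hcell (hs₁ hxP)
    refine mem_iUnion₂.2 ⟨g, ?_, hg⟩
    rw [Finset.mem_inter, hF₁, hF₂]
    exact ⟨m1 g hg, m2 g hg⟩
  · intro x hx
    obtain ⟨g, hg, hxg⟩ := mem_iUnion₂.1 hx
    rw [Finset.mem_inter, hF₁, hF₂] at hg
    exact ⟨upper hw₁ g hg.1 x hxg, upper hw₂ g hg.2 x hxg⟩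
  · exact measure_ne_top_of_subset inter_subset_left (volume_outerRange_ne_top hP₁ _)
  · rintro x (h | h)
    · obtain ⟨hxP, m⟩ := lower hP₁ hs₁ hw₁ x h
      obtain ⟨g, hg⟩ := hcell (hs₁ hxP)
      refine mem_iUnion₂.2 ⟨g, ?_, hg⟩
      rw [Finset.mem_union, hF₁]
      exact Or.inl (m g hg)
    · obtain ⟨hxP, m⟩ := lower hP₂ hs₂ hw₂ x h
      obtain ⟨g, hg⟩ := hcell (hs₂ hxP)
      refine mem_iUnion₂.2 ⟨g, ?_, hg⟩
      rw [Finset.mem_union, hF₂]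
      exact Or.inr (m g hg)
  · intro x hx
    obtain ⟨g, hg, hxg⟩ := mem_iUnion₂.1 hx
    rw [Finset.mem_union, hF₁, hF₂] at hg
    exact hg.imp (fun h => upper hw₁ g h x hxg) (fun h => upper hw₂ g h x hxg)
  · exact (measure_union_lt_top (volume_outerRange_ne_top hP₁ _).lt_top
      (volume_outerRange_ne_top hP₂ _).lt_top).ne
  · have hG : (0 : ℝ) < Fintype.card (Fin p × Fin p) := by
      simp only [Fintype.card_prod, Fintype.card_fin]
      positivity
    unfold density
    field_simp

/-! ### Dense ranges contain many grid points -/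

/-- If the outer range is dense in a square then the diameter is not small. -/
lemma diam_lower_bound {α φ : ℝ} (hα : 0 < α) (hφ : 0 < φ) {o u : Plane} (hu : u ≠ 0)
    {P : Set Plane} (hP : IsPolygon P)
    (h : IsDenseIn α (outerRange P (fuzzWidth φ P)) (square o u)) :
    α * (‖u‖ / 2) ^ 2 ≤ ((1 + φ) * Metric.diam P) ^ 2 := by
  obtain ⟨y, hy⟩ := hP.nonempty
  have hd : 0 ≤ Metric.diam P := Metric.diam_nonneg
  have hu0 : 0 ≤ ‖u‖ := norm_nonneg u
  have hball : ∀ (x : Plane) {r : ℝ}, 0 ≤ r → area (Metric.closedBall x r) = r ^ 2 * Real.pi := by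
    intro x r hr
    rw [area, EuclideanSpace.volume_closedBall_fin_two, ENNReal.toReal_mul, ENNReal.toReal_pow,
      ENNReal.toReal_ofReal hr]
    simp [Real.pi_pos.le]
  have hball' : ∀ (x : Plane) {r : ℝ}, 0 ≤ r → area (Metric.ball x r) = r ^ 2 * Real.pi := by
    intro x r hr
    rw [area, EuclideanSpace.volume_ball_fin_two, ENNReal.toReal_mul, ENNReal.toReal_pow,
      ENNReal.toReal_ofReal hr]
    simp [Real.pi_pos.le]
  have hsq : Bornology.IsBounded (square o u) := by
    refine (Metric.isBounded_closedBall (x := o) (r := 2 * ‖u‖)).subset ?_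
    rintro x ⟨a, ha, b, hb, rfl⟩
    rw [Metric.mem_closedBall, dist_eq_norm, add_assoc, add_sub_cancel_left]
    refine (norm_comb_le _ _ _).trans (mul_le_mul_of_nonneg_right ?_ hu0)
    rw [abs_of_nonneg ha.1, abs_of_nonneg hb.1]
    linarith [ha.2, hb.2]
  -- The inscribed disc is a cruder bound than the area of the square itself, but its factor π
  -- cancels against the disc around P⁺.
  have h1 : (‖u‖ / 2) ^ 2 * Real.pi ≤ area (square o u) := by
    rw [← hball' (o + (1 / 2 : ℝ) • u + (1 / 2 : ℝ) • rot u) (by positivity)]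
    exact ENNReal.toReal_mono hsq.measure_lt_top.ne (measure_mono (ball_subset_square hu))
  have h2 : area (outerRange P (fuzzWidth φ P)) ≤ ((1 + φ) * Metric.diam P) ^ 2 * Real.pi := by
    rw [← hball y (by positivity)]
    refine ENNReal.toReal_mono measure_closedBall_lt_top.ne (measure_mono ?_)
    have := outerRange_subset_closedBall hP hy (fuzzWidth φ P)
    rwa [fuzzWidth, show Metric.diam P + φ * Metric.diam P = (1 + φ) * Metric.diam P by ring]
      at this
  have h3 : (α * (‖u‖ / 2) ^ 2) * Real.pi ≤ ((1 + φ) * Metric.diam P) ^ 2 * Real.pi := by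
    calc _ = α * ((‖u‖ / 2) ^ 2 * Real.pi) := by ring
      _ ≤ α * area (square o u) := by gcongr
      _ ≤ _ := h
      _ ≤ _ := h2
  exact le_of_mul_le_mul_right h3 Real.pi_pos

/-- Near every point of `[0, p - 1]` there are `r` consecutive integers of `{0, …, p - 1}`. -/
lemma exists_near_integers {p r : ℕ} (hr : r < p) {a : ℝ} (ha0 : 0 ≤ a) (ha : a ≤ (p : ℝ) - 1) :
    ∃ F : Finset (Fin p), F.card = r ∧ ∀ i ∈ F, |(i : ℝ) - a| ≤ r := by
  have main : ∃ s : ℕ, s + r ≤ p ∧ ∀ i ∈ Finset.Ico s (s + r), |(i : ℝ) - a| ≤ r := by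
    have h1 := Nat.floor_le ha0
    have h2 := Nat.lt_floor_add_one a
    have h3 : ⌊a⌋₊ < p := by
      rw [Nat.floor_lt ha0]; linarith
    set n := ⌊a⌋₊
    -- Take the `r` integers after ⌊a⌋ if they fit, else start at n + 1 - r; truncation at 0 does no
    -- harm.
    by_cases hn : n + r < p
    · refine ⟨n + 1, by omega, fun i hi => ?_⟩
      obtain ⟨hi1, hi2⟩ := Finset.mem_Ico.1 hi
      have e1 : (n : ℝ) + 1 ≤ i := by exact_mod_cast hi1
      have e2 : (i : ℝ) ≤ n + r := by exact_mod_cast (by omega : i ≤ n + r)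
      rw [abs_le]; constructor <;> linarith
    · refine ⟨n + 1 - r, by omega, fun i hi => ?_⟩
      obtain ⟨hi1, hi2⟩ := Finset.mem_Ico.1 hi
      have e1 : (n : ℝ) + 1 ≤ i + r := by exact_mod_cast (by omega : n + 1 ≤ i + r)
      have e2 : (i : ℝ) ≤ n + r := by exact_mod_cast (by omega : i ≤ n + r)
      rw [abs_le]; constructor <;> linarith
  obtain ⟨s, hs, hF⟩ := main
  refine ⟨(Finset.Ico s (s + r)).attachFin fun i hi => (Finset.mem_Ico.1 hi).2.trans_le hs, ?_, ?_⟩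
  · simp
  · intro i hi
    exact hF i (by simpa using hi)

/-- A point of a polygon in the square of the grid has many grid points nearby. -/
lemma card_gridFinset_ge {o v : Plane} {p r : ℕ} (hr : r < p) {P : Set Plane} (hP : IsPolygon P)
    (hs : P ⊆ square o (((p : ℝ) - 1) • v)) {ρ : ℝ} (hρ : 2 * r * ‖v‖ ≤ ρ) :
    r ^ 2 ≤ (gridFinset o v p (outerRange P ρ)).card := by
  have hne : (interior P).Nonempty := by
    rw [← closure_nonempty_iff, hP.regular]
    exact hP.nonempty
  obtain ⟨y, hy⟩ := hne
  obtain ⟨a, ha, b, hb, hyab⟩ := hs (interior_subset hy)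
  have hp1 : (1 : ℝ) ≤ p := by exact_mod_cast (by omega : 1 ≤ p)
  have hco : ∀ a ∈ Icc (0 : ℝ) 1, 0 ≤ a * ((p : ℝ) - 1) ∧ a * ((p : ℝ) - 1) ≤ (p : ℝ) - 1 :=
    fun a ha => ⟨mul_nonneg ha.1 (by linarith), by nlinarith [ha.2]⟩
  obtain ⟨F, hF, hFa⟩ := exists_near_integers hr (hco a ha).1 (hco a ha).2
  obtain ⟨F', hF', hFb⟩ := exists_near_integers hr (hco b hb).1 (hco b hb).2
  rw [pow_two]
  nth_rw 1 [← hF]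
  rw [← hF', ← Finset.card_product]
  refine Finset.card_le_card fun g hg => ?_
  obtain ⟨h1, h2⟩ := Finset.mem_product.1 hg
  refine mem_gridFinset.2 ⟨y, hy, ?_⟩
  have e : gridPoint o v g.1 g.2 - y = ((g.1 : ℝ) - a * ((p : ℝ) - 1)) • v +
      ((g.2 : ℝ) - b * ((p : ℝ) - 1)) • rot v := by
    rw [hyab, gridPoint, rot_smul, smul_smul, smul_smul, sub_smul, sub_smul]
    abel
  rw [dist_eq_norm, e]
  refine (norm_comb_le _ _ _).trans (le_trans ?_ hρ)
  refine mul_le_mul_of_nonneg_right ?_ (norm_nonneg _)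
  linarith [hFa _ h1, hFb _ h2]

/-- For a sufficiently fine grid, a polygon with a dense outer range is wide compared to the grid
step, and its half range contains a positive fraction of the grid. -/
lemma fuzzWidth_and_density_bounds {α φ : ℝ} (hα : 0 < α) (hα1 : α ≤ 1) (hφ : 0 < φ)
    {o u v : Plane} (hu : u ≠ 0) {p : ℕ} (hp : 2 ≤ p) (huv : ((p : ℝ) - 1) • v = u)
    (hpα : 17 * (1 + φ) / φ ≤ α * p)
    {P : Set Plane} (hP : IsPolygon P) (hPs : P ⊆ square o u)
    (h : IsDenseIn α (outerRange P (fuzzWidth φ P)) (square o u)) :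
    4 * ‖v‖ < fuzzWidth φ P ∧
      (φ / (1 + φ)) ^ 2 / 1024 * α ≤
        density (gridFinset o v p (outerRange P (fuzzWidth φ P / 2))) := by
  have hdiam := diam_lower_bound hα hφ hu hP h
  have hd : 0 ≤ Metric.diam P := Metric.diam_nonneg
  have hp2 : (2 : ℝ) ≤ p := by exact_mod_cast hp
  have hv : v ≠ 0 := by
    rintro rfl
    exact hu (by rw [← huv, smul_zero])
  have hs : 0 < ‖v‖ := norm_pos_iff.2 hv
  have hus : ‖u‖ = ((p : ℝ) - 1) * ‖v‖ := by
    rw [← huv, norm_smul, Real.norm_eq_abs, abs_of_nonneg (by linarith)]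
  set s := ‖v‖
  set d := Metric.diam P
  set q := (p : ℝ) - 1 with hq
  have hq0 : 0 < q := by linarith
  obtain ⟨a, ha0, haα⟩ : ∃ a : ℝ, 0 < a ∧ a ^ 2 = α :=
    ⟨√α, Real.sqrt_pos.2 hα, Real.sq_sqrt hα.le⟩
  have ha1 : a ≤ 1 := by
    by_contra! hc
    nlinarith
  set β := φ / (1 + φ) with hβ
  have hβ0 : 0 < β := by positivity
  have hβ1 : β ≤ 1 := by
    rw [hβ, div_le_one (by positivity)]
    linarith
  have hW : β * a * q / 2 * s ≤ fuzzWidth φ P := by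
    have h1 : a * (q * s / 2) ≤ (1 + φ) * d := by
      rw [hus, ← haα, ← mul_pow] at hdiam
      exact le_of_sq_le_sq hdiam (by positivity)
    calc β * a * q / 2 * s = β * (a * (q * s / 2)) := by ring
      _ ≤ β * ((1 + φ) * d) := by gcongr
      _ = φ * d := by rw [hβ]; field_simp
  -- The bound 17 ≤ β·α·p becomes 8.5 ≤ β·a·q, because α ≤ a = √α and p ≤ 2q.
  have hbig : 8 < β * a * q := by
    have h1 : 17 ≤ β * (α * p) := by
      calc (17 : ℝ) = β * (17 * (1 + φ) / φ) := by rw [hβ]; field_simp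
        _ ≤ _ := by gcongr
    have h2 : α * p ≤ a * (2 * q) := by
      have : α ≤ a := by rw [← haα]; nlinarith
      have : (p : ℝ) ≤ 2 * q := by linarith
      gcongr
    have h3 : β * (α * p) ≤ β * (a * (2 * q)) := by gcongr
    linarith
  refine ⟨by nlinarith, ?_⟩
  -- Chosen so that the distance 2x‖v‖ is at most half the width; x > 1 makes its floor at least
  -- x/2.
  set x := β * a * q / 8 with hx
  have hx1 : 1 < x := by linarith
  have hr1 := Nat.floor_le (a := x) (by linarith)
  have hr2 := Nat.lt_floor_add_one x
  have hxq : x ≤ q := by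
    have : β * a ≤ 1 := mul_le_one₀ hβ1 ha0.le ha1
    have : β * a * q ≤ 1 * q := by gcongr
    linarith
  set r := ⌊x⌋₊
  have hr1' : (1 : ℝ) ≤ r := by exact_mod_cast (Nat.le_floor (by exact_mod_cast hx1.le) : 1 ≤ r)
  have hrp : r < p := by
    have : (r : ℝ) < p := by linarith
    exact_mod_cast this
  have hcard := card_gridFinset_ge hrp hP (o := o) (v := v) (by rwa [huv])
    (ρ := fuzzWidth φ P / 2) (by
      have : (r : ℝ) * s ≤ x * s := by gcongr
      change 2 * r * s ≤ _
      nlinarith)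
  have hrx : x / 2 ≤ r := by linarith
  have hcard' : x ^ 2 / 4 ≤ (gridFinset o v p (outerRange P (fuzzWidth φ P / 2))).card := by
    calc x ^ 2 / 4 = (x / 2) ^ 2 := by ring
      _ ≤ (r : ℝ) ^ 2 := by gcongr
      _ ≤ _ := by exact_mod_cast hcard
  have hpq : (p : ℝ) / 2 ≤ q := by linarith
  rw [density, Fintype.card_prod, Fintype.card_fin, le_div_iff₀ (by positivity)]
  push_cast
  refine le_trans ?_ hcard'
  -- 1024 = 8² · 4 · 4, from the 8 in x, the floor, and q ≥ p/2.
  calc β ^ 2 / 1024 * α * (p * p) = (β * a / 8) ^ 2 / 4 * (p / 2) ^ 2 := by rw [← haα]; ring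
    _ ≤ (β * a / 8) ^ 2 / 4 * q ^ 2 := by gcongr
    _ = x ^ 2 / 4 := by rw [hx]; ring

/-- An odd prime is not a power of two; so the modulus itself fits into a word. -/
lemma lt_two_pow_of_prime {p w : ℕ} (hp : p.Prime) (h2 : 2 < p) (hw : p ≤ 2 ^ w) :
    p < 2 ^ w := by
  refine lt_of_le_of_ne hw fun h => ?_
  have := (Nat.prime_dvd_prime_iff_eq hp Nat.prime_two).1 (hp.dvd_of_dvd_pow h.dvd)
  omega

end GeomLSH

/-! ### The main theorem: choice of the constants -/

open GeomLSH
theorem theorem2 (ε φ : ℝ) (hε : 0 < ε) (hφ : 0 < φ) :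
    ∃ (prog : Program) (k₁ k₂ : ℕ) (C : ℝ), 0 < C ∧
      ∀ (o u : Plane), u ≠ 0 → ∀ α : ℝ, 0 < α → α ≤ 1 →
      ∀ p : ℕ, p.Prime → C / α ≤ p → ∀ w : ℕ, p ≤ 2 ^ w →
      -- a `p × p` grid whose enclosing square contains `I = square o u`,
      -- the fixed words of the description, and the random hash function
      ∃ (o' v : Plane) (params : List (BitVec w))
        (H : (Fin k₂ → Fin p) → Set Plane → BitVec w),
        v ≠ 0 ∧ square o u ⊆ square o' (((p : ℝ) - 1) • v) ∧ params.length = k₁ ∧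
        -- evaluation time
        (∀ P : Set Plane, IsPolygon P → P ⊆ square o u →
          ∀ (seed : Fin k₂ → Fin p) (t : ℕ), 1 ≤ t →
          ∃ T : ℕ, Runs prog (insideTest φ o' v p P) t
              (initConfig (description params seed)) (H seed P) T ∧
            (T : ℝ) ≤ C * ((t : ℝ) * Real.log p / α)) ∧
        -- collision probability
        ∀ P₁ P₂ : Set Plane, IsPolygon P₁ → IsPolygon P₂ →
          P₁ ⊆ square o u → P₂ ⊆ square o u →
          IsDenseIn α (outerRange P₁ (fuzzWidth φ P₁)) (square o u) →
          IsDenseIn α (outerRange P₂ (fuzzWidth φ P₂)) (square o u) →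
          ∃ J : ℝ, IsValidJaccard φ P₁ P₂ J ∧
            collisionProb H P₁ P₂ ∈ Icc (J - ε) (J + ε) := by
  obtain ⟨k, c, hc, happrox⟩ := exists_collision_approx hε
  obtain ⟨κ, hκ⟩ : ∃ κ : ℝ, κ = (φ / (1 + φ)) ^ 2 / 1024 := ⟨_, rfl⟩
  have hκ0 : 0 < κ := by rw [hκ]; positivity
  -- The first summand bounds the running time and gives m ≤ p. The second gives enough addresses, k
  -- ≤ p and log p ≥ 1, and the third a sufficiently fine grid.
  obtain ⟨C, hC⟩ : ∃ C : ℝ,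
      C = (c / κ + 1) * (8 * k + 4) + (2 * k + 16) + 17 * (1 + φ) / φ := ⟨_, rfl⟩
  have hcκ : 0 < c / κ := by positivity
  have hφ17 : 0 < 17 * (1 + φ) / φ := by positivity
  have hk0 : (0 : ℝ) ≤ k := by positivity
  have hprod : 0 ≤ (c / κ + 1) * (8 * k) := by positivity
  refine ⟨sampleProg (2 * k), 6, 2 * k, C, by rw [hC]; positivity, ?_⟩
  intro o u hu α hα hα1 p hp hCp w hw
  have hαp : C ≤ α * p := by
    rw [div_le_iff₀ hα] at hCp
    linarith
  have hpC : C ≤ p := by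
    refine hαp.trans ?_
    have : (0 : ℝ) ≤ p := by positivity
    nlinarith
  have hpk : 2 * k + 16 ≤ p := by
    have : (2 * k + 16 : ℝ) ≤ p := by
      refine le_trans ?_ hpC
      rw [hC]
      linarith
    exact_mod_cast this
  have hpw : p < 2 ^ w := lt_two_pow_of_prime hp (by omega) hw
  have : Fact p.Prime := ⟨hp⟩
  have hp2 : (16 : ℝ) ≤ p := by exact_mod_cast (by omega : 16 ≤ p)
  have hp1 : (p : ℝ) - 1 ≠ 0 := by linarith
  set v := ((p : ℝ) - 1)⁻¹ • u with hv
  have huv : ((p : ℝ) - 1) • v = u := smul_inv_smul₀ hp1 u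
  have hv0 : v ≠ 0 := smul_ne_zero (inv_ne_zero hp1) hu
  -- Enough samples for hit density κα. The cutoff also bounds the time for polygons whose range is
  -- not dense.
  set m := ⌈c / (κ * α)⌉₊ with hm
  have hm0 : 0 < m := Nat.ceil_pos.2 (by positivity)
  have hmle : (m : ℝ) ≤ (c / κ + 1) / α := by
    have h1 := (Nat.ceil_lt_add_one (a := c / (κ * α)) (by positivity)).le
    refine h1.trans ?_
    rw [add_div, ← div_div]
    have : 1 ≤ 1 / α := by rw [le_div_iff₀ hα]; linarith
    linarith
  have hmp : m ≤ p := by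
    have : (m : ℝ) ≤ p := by
      refine hmle.trans (le_trans ?_ hCp)
      gcongr
      rw [hC]
      linarith
    exact_mod_cast this
  refine ⟨o, v, sampleParams w m p, fun seed P => BitVec.ofNat w (firstHit m fun n =>
    insideTest φ o v p P (diffTable p (seedTable seed) n 0) (diffTable p (seedTable seed) n 1)),
    hv0, by rw [huv], rfl, ?_, ?_⟩
  · intro P _ _ seed t ht
    obtain ⟨T, hT, hrun⟩ := runs_sampleProg (insideTest φ o v p P) (m := m) (by omega) hp.pos hpw
      hm0 (by omega) ht seed
    refine ⟨T, hrun, ?_⟩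
    -- The program takes time O(t/α); the factor log p is only inserted.
    have hlog : 1 ≤ Real.log p := by
      rw [Real.le_log_iff_exp_le (by linarith)]
      linarith [Real.exp_one_lt_d9]
    have hC0 : 0 ≤ C := by rw [hC]; positivity
    have hC1 : (c / κ + 1) * (8 * k + 4) ≤ C := by rw [hC]; linarith
    calc (T : ℝ) ≤ m * ((4 * (2 * k) + 4) * t) := by exact_mod_cast hT
      _ ≤ (c / κ + 1) / α * ((4 * (2 * k) + 4) * t) := by gcongr
      _ = ((c / κ + 1) * (8 * k + 4)) * (t * 1 / α) := by ring
      _ ≤ C * ((t : ℝ) * Real.log p / α) := by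
        gcongr
  · intro P₁ P₂ hP₁ hP₂ hs₁ hs₂ hd₁ hd₂
    have hα17 : 17 * (1 + φ) / φ ≤ α * p := by
      refine le_trans ?_ hαp
      rw [hC]
      nlinarith
    obtain ⟨hw₁, hF₁⟩ := fuzzWidth_and_density_bounds hα hα1 hφ hu (by omega) huv hα17 hP₁ hs₁ hd₁
    obtain ⟨hw₂, -⟩ := fuzzWidth_and_density_bounds hα hα1 hφ hu (by omega) huv hα17 hP₂ hs₂ hd₂
    rw [← hκ] at hF₁
    set F₁ := gridFinset o v p (outerRange P₁ (fuzzWidth φ P₁ / 2)) with hF₁def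
    set F₂ := gridFinset o v p (outerRange P₂ (fuzzWidth φ P₂ / 2)) with hF₂def
    have hδ : κ * α ≤ density (F₁ ∪ F₂) := hF₁.trans (density_mono Finset.subset_union_left)
    have hκα : 0 < κ * α := by positivity
    have hne : (F₁ ∪ F₂).Nonempty := by
      rw [Finset.nonempty_iff_ne_empty]
      intro h
      rw [h] at hδ
      simp only [density, Finset.card_empty, Nat.cast_zero, zero_div] at hδ
      linarith
    refine ⟨density (F₁ ∩ F₂) / density (F₁ ∪ F₂), isValidJaccard_grid hv0 hp.pos hP₁ hP₂
      (by rwa [huv]) (by rwa [huv]) hw₁ hw₂ hF₁def hF₂def hne, ?_⟩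
    have happ := happrox (samplePoint_kWiseUniform (k := k) (by omega)) F₁ F₂ hκα hδ hmp
      (Nat.le_ceil _)
    have hhit : ∀ (P : Set Plane) (seed : Fin (2 * k) → Fin p),
        (firstHit m fun n => insideTest φ o v p P (diffTable p (seedTable seed) n 0)
          (diffTable p (seedTable seed) n 1)) =
        firstHit m fun n => samplePoint n seed ∈
          gridFinset o v p (outerRange P (fuzzWidth φ P / 2)) := by
      intro P seed
      congr 1
      funext n
      rw [mem_gridFinset]
      simp only [insideTest, samplePoint]
      have h0 := (samplePoint n seed).1.2
      have h1 := (samplePoint n seed).2.2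
      simp only [samplePoint] at h0 h1
      simp only [h0, h1, true_and]
    have hcol : ∀ seed : Fin (2 * k) → Fin p,
        (BitVec.ofNat w (firstHit m fun n => insideTest φ o v p P₁
            (diffTable p (seedTable seed) n 0) (diffTable p (seedTable seed) n 1)) =
          BitVec.ofNat w (firstHit m fun n => insideTest φ o v p P₂
            (diffTable p (seedTable seed) n 0) (diffTable p (seedTable seed) n 1))) ↔
        firstHit m (fun n => samplePoint n seed ∈ F₁) =
          firstHit m (fun n => samplePoint n seed ∈ F₂) := by
      intro seed
      -- Indices are at most m ≤ p < 2^w, so equal words mean equal indices.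
      rw [addr_inj ((firstHit_le _ _).trans_lt (by omega))
        ((firstHit_le _ _).trans_lt (by omega)), hhit P₁, hhit P₂]
    rw [Fintype.card_fun, Fintype.card_fin, Fintype.card_fin, Nat.cast_pow,
      ← Nat.card_congr (Equiv.subtypeEquivRight hcol), abs_le] at happ
    rw [collisionProb, mem_Icc]
    constructor <;> linarith [happ.1, happ.2]
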